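/- **Parameters.** Fix sets of base types $\iota$, constants $a,b$, binary operators $op$ and blame labels $p$; each constant has a base type $ty(a)$, each operator a type $ty(op)=\iota_1\to\iota_2\to\iota$, and a partial function $\delta(op,a,b)$ on constants is given such that, if $ty(op)=\iota_1\to\iota_2\to\iota$, $ty(a)=\iota_1$ and $ty(b)=\iota_2$, then $\delta(op,a,b)$ is defined and is a constant of type $\iota$. Terms are identified up to $\alpha$-equivalence. **The calculus $\lambda\mathsf S$.** *Types* $A,B::=\star\mid\iota\mid A\to B$; *ground types* $G,H::=\iota\mid\star\to\star$; *consistency* $\sim$ is generated by $\iota\sim\iota$, $A\sim\star$, $\star\sim A$, and $A\to B\sim A'\to B'$ if $A\sim A'$ and $B\sim B'$. *Space-efficient, intermediate, ground and delayed coercions*: $s,t::=\mathrm{id}_\star\mid G?^p;i\mid i$; $\; i::=g;G!\mid g\mid\bot^{GpH}$; $\; g,h::=\mathrm{id}_A\ (A\neq\star)\mid s\to t\ (s,t\text{ not both identities})$; $\; d::=g;G!\mid s\to t\ (s,t\text{ not both identities})$. *Coercion typing* $c:A\rightsquigarrow B$: $\mathrm{id}_A:A\rightsquigarrow A$; $(g;G!):A\rightsquigarrow\star$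 if $g:A\rightsquigarrow G$; $(G?^p;i):\star\rightsquigarrow B$ if $i:G\rightsquigarrow B$; $(s\to t):A\to B\rightsquigarrow A'\to B'$ if $s:A'\rightsquigarrow A$ and $t:B\rightsquigarrow B'$; $\bot^{GpH}:A\rightsquigarrow B$ if $A\ne\star$, $A\sim G$, $G\neq H$. *Composition*, written $s\circ t$ (first $s$, then $t$), is the partial function given by $\mathrm{id}_\star\circ t=t$; $\;(G?^p;i)\circ t=G?^p;(i\circ t)$; $\;(g;G!)\circ \mathrm{id}_\star=g;G!$; $\;(g;G!)\circ (G?^p;i)=g\circ i$; $\;(g;G!)\circ (H?^p;i)=\bot^{GpH}$ if $G\ne H$; $\;\bot^{GpH}\circ s=\bot^{GpH}$; $\;g\circ \bot^{GpH}=\bot^{GpH}$; $\;g\circ (h;H!)=(g\circ h);H!$; $\;\mathrm{id}_A\circ g=g$ if $A\neq\star$; $\;g\circ \mathrm{id}_A=g$ if $A\ne\star$ and $g\neq\mathrm{id}_A$; and $(s\to t)\circ (s'\to t')$ is $\mathrm{id}_{A\to B}$ if $s'\circ s=\mathrm{id}_A$ and $t\circ t'=\mathrm{id}_B$, and $(s'\circ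 s)\to(t\circ t')$ otherwise. *Terms* $M,N::=V\mid op(M,N)\mid M\,N\mid M\langle s\rangle\mid\mathrm{blame}\,p$; *values* $V::=x\mid U\mid U\langle\langle d\rangle\rangle$; *uncoerced values* $U::=a\mid\lambda x.M$. *Typing* $\Gamma\vdash M:A$: the usual rules for $a$ (of type $ty(a)$), $op(M,N)$, $x$, $\lambda x.M$ (of type $A\to B$ if $\Gamma,x:A\vdash M:B$) and $M\,N$; $\Gamma\vdash M\langle s\rangle:B$ if $\Gamma\vdash M:A$ and $s:A\rightsquigarrow B$; $\Gamma\vdash U\langle\langle d\rangle\rangle:B$ if $\Gamma\vdash U:A$ and $d:A\rightsquigarrow B$; $\Gamma\vdash\mathrm{blame}\,p:A$ for all $A$. *Evaluation contexts* $\mathcal E::=\mathcal F\mid\mathcal F[\square\langle s\rangle]$, $\;\mathcal F::=\square\mid\mathcal E[op(\square,M)]\mid\mathcal E[op(V,\square)]\mid\mathcal E[\square\,M]\mid\mathcal E[V\,\square]$. *Reductions labelled* $\mathsf e$: $op(a,b)\to\delta(op,a,b)$; $(\lambda x.M)V\to M[x:=V]$; $(U\langle\langle s\to t\rangle\rangle)V\to(U(V\langle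 s\rangle))\langle t\rangle$. *Labelled* $\mathsf c$: $U\langle\mathrm{id}_A\rangle\to U$; $U\langle\bot^{GpH}\rangle\to\mathrm{blame}\,p$; $U\langle d\rangle\to U\langle\langle d\rangle\rangle$; $M\langle s\rangle\langle t\rangle\to M\langle s\circ t\rangle$; $U\langle\langle d\rangle\rangle\langle t\rangle\to U\langle d\circ t\rangle$. *Evaluation* $\longmapsto_{\mathsf S}$: $\mathcal E[M]\longmapsto\mathcal E[N]$ if $M\to N$ is labelled $\mathsf e$; $\mathcal F[M]\longmapsto\mathcal F[N]$ if $M\to N$ is labelled $\mathsf c$; $\mathcal E[\mathrm{blame}\,p]\longmapsto\mathrm{blame}\,p$ if $\mathcal E\ne\square$. **The calculus $\lambda\mathsf S_1$.** Types are $\star\mid\iota\mid A\rightsquigarrow B\mid A\Rightarrow B\mid X$; ground types, coercions and composition are as in $\lambda\mathsf S$ with $\Rightarrow$ for $\to$. *Terms* $L,M,N::=V\mid op(M,N)\mid L(M,N)\mid\mathrm{let}\,x=M\,\mathrm{in}\,N\mid M;\!;N\mid M\langle N\rangle\mid\mathrm{blame}\,p$; *values* $V,W,K::=x\mid U\mid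 U\langle\langle d\rangle\rangle$; *uncoerced values* $U::=a\mid\lambda(x,\kappa).M\mid s$. *Contexts* $\mathcal E::=\square\mid\mathcal E[\square(M,N)]\mid\mathcal E[V(\square,N)]\mid\mathcal E[V(W,\square)]\mid\mathcal E[op(\square,M)]\mid\mathcal E[op(V,\square)]\mid\mathcal E[\mathrm{let}\,x=\square\,\mathrm{in}\,M]\mid\mathcal E[\square;\!;M]\mid\mathcal E[V;\!;\square]\mid\mathcal E[\square\langle M\rangle]\mid\mathcal E[V\langle\square\rangle]$. *Reductions*: $op(a,b)\to\delta(op,a,b)$; $(\lambda(x,\kappa).M)(V,W)\to M[x:=V,\kappa:=W]$; $(U\langle\langle s\Rightarrow t\rangle\rangle)(V,W)\to\mathrm{let}\,\kappa=t;\!;W\,\mathrm{in}\,U(V\langle s\rangle,\kappa)$ with $\kappa$ fresh; $\mathrm{let}\,x=V\,\mathrm{in}\,M\to M[x:=V]$; $s;\!;t\to s\circ t$; $U\langle\mathrm{id}_A\rangle\to U$; $U\langle\bot^{GpH}\rangle\to\mathrm{blame}\,p$; $U\langle d\rangle\to U\langle\langle d\rangle\rangle$; $U\langle\langle d\rangle\rangle\langle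 t\rangle\to U\langle d;\!;t\rangle$. *Evaluation* $\longmapsto_{\mathsf S_1}$: $\mathcal E[M]\longmapsto\mathcal E[N]$ if $M\to N$; $\mathcal E[\mathrm{blame}\,p]\longmapsto\mathrm{blame}\,p$ if $\mathcal E\neq\square$. **Coercion-passing translation.** $\Psi$ replaces $\to$ by $\Rightarrow$ in types, ground types and coercions. On typing derivations of $\lambda\mathsf S$-terms (written as terms, $M^A$ meaning that the derivation gives $M$ the type $A$), $\Psi$ on values, $\mathcal C$ and $\mathcal K$ (with $K$ a variable or a coercion of $\lambda\mathsf S_1$) are defined by mutual recursion: $\Psi(x)=x$, $\Psi(a)=a$, $\Psi(\lambda x.M)=\lambda(x,\kappa).\mathcal K[\![M]\!]\kappa$, $\Psi(U\langle\langle d\rangle\rangle)=\Psi(U)\langle\langle\Psi(d)\rangle\rangle$; $\mathcal C[\![V]\!]=\Psi(V)$, $\mathcal C[\![M\langle s\rangle]\!]=\mathcal K[\![M]\!]\Psi(s)$, and $\mathcal C[\![M^A]\!]=\mathcal K[\![M]\!]\mathrm{id}_{\Psi(A)}$ otherwise; $\mathcal K[\![V]\!]K=\Psi(V)\langle K\rangle$,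 $\mathcal K[\![op(M,N)]\!]K=op(\mathcal C[\![M]\!],\mathcal C[\![N]\!])\langle K\rangle$, $\mathcal K[\![M\,N]\!]K=\mathcal C[\![M]\!](\mathcal C[\![N]\!],K)$, $\mathcal K[\![M\langle s\rangle]\!]K=\mathrm{let}\,\kappa=\Psi(s);\!;K\,\mathrm{in}\,\mathcal K[\![M]\!]\kappa$, $\mathcal K[\![\mathrm{blame}\,p]\!]K=\mathrm{blame}\,p$ ($\kappa$ fresh). **Theorem (Translation Preserves Semantics).** Let $\emptyset\vdash M:\iota$ in $\lambda\mathsf S$ for a base type $\iota$, and let $\mathcal C[\![M]\!]$ be its translation along any derivation of this judgment. Write $\longmapsto^*$ for the reflexive transitive closure of $\longmapsto$, and say that a term diverges if there is an infinite evaluation sequence starting from it. Then 1. for every constant $a$: $M\longmapsto_{\mathsf S}^*a$ if and only if $\mathcal C[\![M]\!]\longmapsto_{\mathsf S_1}^*a$; 2. for every label $p$: $M\longmapsto_{\mathsf S}^*\mathrm{blame}\,p$ if and only if $\mathcal C[\![M]\!]\longmapsto_{\mathsf S_1}^*\mathrm{blame}\,p$; 3. $M$ diverges in $\lambda\mathsf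 S$ if and only if $\mathcal C[\![M]\!]$ diverges in $\lambda\mathsf S_1$. -/

import Mathlib

/-- The parameters of both calculi: base types, constants, binary operators and blame labels,
with the typing of constants and operators and the partial interpretation `delta` of operators,
which is assumed to be defined, with a result of the right type, on well-typed arguments. -/
structure Signature where
  Base : Type
  Const : Type
  Op : Type
  Label : Type
  tyConst : Const → Base
  /-- `ty(op) = opArg₁ op → opArg₂ op → opRes op` -/
  opArg₁ : Op → Base
  opArg₂ : Op → Base
  opRes : Op → Base
  delta : Op → Const → Const → Option Const
  delta_spec : ∀ (o : Op) (a b : Const), tyConst a = opArg₁ o → tyConst b = opArg₂ o →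
    ∃ c, delta o a b = some c ∧ tyConst c = opRes o

/-! ## The source calculus `λS` -/

namespace LamS

/-- Types `A, B ::= ⋆ | ι | A → B`. -/
inductive Ty (S : Signature) : Type
  | dyn : Ty S
  | base (ι : S.Base) : Ty S
  | arr (A B : Ty S) : Ty S

/-- Ground types `G, H ::= ι | ⋆ → ⋆`. -/
inductive Ground (S : Signature) : Type
  | base (ι : S.Base) : Ground S
  | arr : Ground S

def Ground.toTy {S : Signature} : Ground S → Ty S
  | .base ι => .base ι
  | .arr => .arr .dyn .dyn

/-- Type consistency `A ∼ B`. -/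
inductive Consistent {S : Signature} : Ty S → Ty S → Prop
  | base (ι : S.Base) : Consistent (.base ι) (.base ι)
  | dynR (A : Ty S) : Consistent A .dyn
  | dynL (A : Ty S) : Consistent .dyn A
  | arr {A A' B B' : Ty S} : Consistent A A' → Consistent B B' →
      Consistent (.arr A B) (.arr A' B')

/-- Raw coercions: `id_A`, `g ; G!`, `G?ᵖ ; i`, `s → t`, `⊥^{GpH}`.
Which of them are space-efficient is said by `Gram`. -/
inductive Crc (S : Signature) : Type
  | id (A : Ty S) : Crc S
  | inj (g : Crc S) (G : Ground S) : Crc S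
  | proj (G : Ground S) (p : S.Label) (i : Crc S) : Crc S
  | arr (s t : Crc S) : Crc S
  | fail (G : Ground S) (p : S.Label) (H : Ground S) : Crc S

/-- `s = id_A` for some type `A`. -/
def Crc.IsId {S : Signature} (s : Crc S) : Prop := ∃ A, s = .id A

/-- The three syntactic categories of coercions. -/
inductive Cat : Type
  | space
  | inter
  | ground

/-- `Gram .space s`, `Gram .inter i`, `Gram .ground g`: the grammar of space-efficient,
intermediate and ground coercions
`s ::= id_⋆ | G?ᵖ ; i | i`, `i ::= g ; G! | g | ⊥^{GpH}`,
`g ::= id_A (A ≠ ⋆) | s → t (s ≠ id or t ≠ id)`. -/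
inductive Gram {S : Signature} : Cat → Crc S → Prop
  | idDyn : Gram .space (.id .dyn)
  | proj {G : Ground S} {p : S.Label} {i : Crc S} : Gram .inter i → Gram .space (.proj G p i)
  | ofInter {i : Crc S} : Gram .inter i → Gram .space i
  | inj {g : Crc S} {G : Ground S} : Gram .ground g → Gram .inter (.inj g G)
  | ofGround {g : Crc S} : Gram .ground g → Gram .inter g
  | fail {G : Ground S} {p : S.Label} {H : Ground S} : Gram .inter (.fail G p H)
  | id {A : Ty S} : A ≠ .dyn → Gram .ground (.id A)
  | arr {s t : Crc S} : Gram .space s → Gram .space t → (¬ s.IsId ∨ ¬ t.IsId) →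
      Gram .ground (.arr s t)

/-- The delayed coercions `d ::= g ; G! | s → t` among the space-efficient ones. -/
inductive IsDelayed {S : Signature} : Crc S → Prop
  | inj (g : Crc S) (G : Ground S) : IsDelayed (.inj g G)
  | arr (s t : Crc S) : IsDelayed (.arr s t)

/-- Well-formed coercions `c : A ⇝ B`. -/
inductive CrcTy {S : Signature} : Crc S → Ty S → Ty S → Prop
  | id (A : Ty S) : CrcTy (.id A) A A
  | inj {g : Crc S} {A : Ty S} {G : Ground S} : CrcTy g A G.toTy → CrcTy (.inj g G) A .dyn
  | proj {i : Crc S} {B : Ty S} {G : Ground S} {p : S.Label} : CrcTy i G.toTy B →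
      CrcTy (.proj G p i) .dyn B
  | arr {s t : Crc S} {A A' B B' : Ty S} : CrcTy s A' A → CrcTy t B B' →
      CrcTy (.arr s t) (.arr A B) (.arr A' B')
  | fail {A B : Ty S} {G H : Ground S} {p : S.Label} : A ≠ .dyn → Consistent A G.toTy → G ≠ H →
      CrcTy (.fail G p H) A B

/-- `s → t`, except that `id_A → id_B` is normalized to `id_{A → B}`. -/
def Crc.mkArr {S : Signature} : Crc S → Crc S → Crc S
  | .id A, .id B => .id (.arr A B)
  | s, t => .arr s t

open Classical in
/-- Coercion composition `s ⨟ t`, a partial function (`none` when no rule applies, which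
never happens for coercions with matching target and source types). -/
noncomputable def Crc.comp {S : Signature} : Crc S → Crc S → Option (Crc S)
  | .id .dyn, t => some t
  | .proj G p i, t => (Crc.comp i t).map (Crc.proj G p)
  | .inj g G, .id .dyn => some (.inj g G)
  | .inj g G, .proj H p i => if G = H then Crc.comp g i else some (.fail G p H)
  | .fail G p H, _ => some (.fail G p H)
  | .id _, .fail G p H => some (.fail G p H)
  | .arr _ _, .fail G p H => some (.fail G p H)
  | .id A, .inj h H => (Crc.comp (.id A) h).map (fun c => Crc.inj c H)
  | .arr s t, .inj h H => (Crc.comp (.arr s t) h).map (fun c => Crc.inj c H)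
  | .id _, .id B => if B = .dyn then none else some (.id B)
  | .id _, .arr s t => some (.arr s t)
  | .arr s t, .id B => if B = .dyn then none else some (.arr s t)
  | .arr s t, .arr s' t' =>
      (Crc.comp s' s).bind fun u => (Crc.comp t t').map fun v => Crc.mkArr u v
  | _, _ => none
termination_by s t => sizeOf s + sizeOf t

/-- Terms, in de Bruijn notation (index `0` is the innermost binder).
`crc M s` is the coercion application `M⟨s⟩`; `crcV U d` is the coerced value `U⟪d⟫`. -/
inductive Term (S : Signature) : Type
  | var (n : ℕ) : Term S
  | const (a : S.Const) : Term S
  | lam (M : Term S) : Term S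
  | crcV (U : Term S) (d : Crc S) : Term S
  | op (o : S.Op) (M N : Term S) : Term S
  | app (M N : Term S) : Term S
  | crc (M : Term S) (s : Crc S) : Term S
  | blame (p : S.Label) : Term S

/-- Uncoerced values `U ::= a | λx.M`. -/
inductive IsUncoerced {S : Signature} : Term S → Prop
  | const (a : S.Const) : IsUncoerced (.const a)
  | lam (M : Term S) : IsUncoerced (.lam M)

/-- Values `V ::= x | U | U⟪d⟫`. -/
inductive IsValue {S : Signature} : Term S → Prop
  | var (n : ℕ) : IsValue (.var n)
  | unc {U : Term S} : IsUncoerced U → IsValue U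
  | crcV {U : Term S} {d : Crc S} : IsUncoerced U → IsDelayed d → IsValue (.crcV U d)

/-- Extension of a renaming under one binder. -/
def upRen (ξ : ℕ → ℕ) : ℕ → ℕ
  | 0 => 0
  | n + 1 => ξ n + 1

def Term.rename {S : Signature} (ξ : ℕ → ℕ) : Term S → Term S
  | .var n => .var (ξ n)
  | .const a => .const a
  | .lam M => .lam (M.rename (upRen ξ))
  | .crcV U d => .crcV (U.rename ξ) d
  | .op o M N => .op o (M.rename ξ) (N.rename ξ)
  | .app M N => .app (M.rename ξ) (N.rename ξ)
  | .crc M s => .crc (M.rename ξ) s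
  | .blame p => .blame p

/-- Extension of a substitution under one binder. -/
def upSub {S : Signature} (σ : ℕ → Term S) : ℕ → Term S
  | 0 => .var 0
  | n + 1 => (σ n).rename Nat.succ

/-- Capture-avoiding simultaneous substitution. -/
def Term.subst {S : Signature} (σ : ℕ → Term S) : Term S → Term S
  | .var n => σ n
  | .const a => .const a
  | .lam M => .lam (M.subst (upSub σ))
  | .crcV U d => .crcV (U.subst σ) d
  | .op o M N => .op o (M.subst σ) (N.subst σ)
  | .app M N => .app (M.subst σ) (N.subst σ)
  | .crc M s => .crc (M.subst σ) s
  | .blame p => .blame p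

/-- `M[x := V]` for the variable `x` with index `0`. -/
def Term.subst1 {S : Signature} (M V : Term S) : Term S :=
  M.subst fun n => match n with
    | 0 => V
    | n + 1 => .var n

/-- Derivations of the typing judgment `Γ ⊢ M : A`. The terms `U⟪d⟫` and `blame p` arise at
run time only, with the empty environment or, after having been substituted under binders, with
an arbitrary one. -/
inductive Deriv {S : Signature} : List (Ty S) → Term S → Ty S → Type
  | const (Γ : List (Ty S)) (a : S.Const) : Deriv Γ (.const a) (.base (S.tyConst a))
  | op {Γ : List (Ty S)} {M N : Term S} (o : S.Op) :
      Deriv Γ M (.base (S.opArg₁ o)) → Deriv Γ N (.base (S.opArg₂ o)) →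
      Deriv Γ (.op o M N) (.base (S.opRes o))
  | var {Γ : List (Ty S)} {A : Ty S} (n : ℕ) : Γ[n]? = some A → Deriv Γ (.var n) A
  | lam {Γ : List (Ty S)} {M : Term S} {A B : Ty S} :
      Deriv (A :: Γ) M B → Deriv Γ (.lam M) (.arr A B)
  | app {Γ : List (Ty S)} {M N : Term S} {A B : Ty S} :
      Deriv Γ M (.arr A B) → Deriv Γ N A → Deriv Γ (.app M N) B
  | crc {Γ : List (Ty S)} {M : Term S} {A B : Ty S} (s : Crc S) :
      Deriv Γ M A → Gram .space s → CrcTy s A B → Deriv Γ (.crc M s) B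
  | crcV {Γ : List (Ty S)} {U : Term S} {A B : Ty S} (d : Crc S) :
      IsUncoerced U → Deriv Γ U A → Gram .space d → IsDelayed d → CrcTy d A B →
      Deriv Γ (.crcV U d) B
  | blame (Γ : List (Ty S)) (p : S.Label) (A : Ty S) : Deriv Γ (.blame p) A

/-- Reduction labelled `e`. -/
inductive RedE {S : Signature} : Term S → Term S → Prop
  | op {o : S.Op} {a b c : S.Const} : S.delta o a b = some c →
      RedE (.op o (.const a) (.const b)) (.const c)
  | beta {M V : Term S} : IsValue V → RedE (.app (.lam M) V) (M.subst1 V)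
  | wrap {U V : Term S} {s t : Crc S} : IsUncoerced U → IsValue V →
      RedE (.app (.crcV U (.arr s t)) V) (.crc (.app U (.crc V s)) t)

/-- Reduction labelled `c`. -/
inductive RedC {S : Signature} : Term S → Term S → Prop
  | id {U : Term S} {A : Ty S} : IsUncoerced U → RedC (.crc U (.id A)) U
  | fail {U : Term S} {G H : Ground S} {p : S.Label} : IsUncoerced U →
      RedC (.crc U (.fail G p H)) (.blame p)
  | crc {U : Term S} {d : Crc S} : IsUncoerced U → IsDelayed d → RedC (.crc U d) (.crcV U d)
  | mergeC {M : Term S} {s t u : Crc S} : s.comp t = some u →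
      RedC (.crc (.crc M s) t) (.crc M u)
  | mergeV {U : Term S} {d t u : Crc S} : IsUncoerced U → IsDelayed d → d.comp t = some u →
      RedC (.crc (.crcV U d) t) (.crc U u)

/-- Evaluation contexts, inside-out. `Ctx false` consists of the contexts `ℱ`, whose innermost
frame is not a coercion application, `Ctx true` of the contexts `ℱ[□⟨s⟩]`; the contexts `ℰ` are
those of both kinds. -/
inductive Ctx (S : Signature) : Bool → Type
  | hole : Ctx S false
  | opL {b : Bool} (E : Ctx S b) (o : S.Op) (N : Term S) : Ctx S false
  | opR {b : Bool} (E : Ctx S b) (o : S.Op) (V : Term S) (hV : IsValue V) : Ctx S false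
  | appL {b : Bool} (E : Ctx S b) (N : Term S) : Ctx S false
  | appR {b : Bool} (E : Ctx S b) (V : Term S) (hV : IsValue V) : Ctx S false
  | crc (F : Ctx S false) (s : Crc S) : Ctx S true

/-- `ℰ[M]` -/
def Ctx.plug {S : Signature} : {b : Bool} → Ctx S b → Term S → Term S
  | _, .hole, M => M
  | _, .opL E o N, M => E.plug (.op o M N)
  | _, .opR E o V _, M => E.plug (.op o V M)
  | _, .appL E N, M => E.plug (.app M N)
  | _, .appR E V _, M => E.plug (.app V M)
  | _, .crc F s, M => F.plug (.crc M s)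

/-- `ℰ = □` -/
def Ctx.IsHole {S : Signature} : {b : Bool} → Ctx S b → Prop
  | _, .hole => True
  | _, _ => False

/-- Evaluation labelled `e`. -/
inductive EvalE {S : Signature} : Term S → Term S → Prop
  | ctx {b : Bool} (E : Ctx S b) {M N : Term S} : RedE M N → EvalE (E.plug M) (E.plug N)
  | abort {b : Bool} (E : Ctx S b) (p : S.Label) : ¬ E.IsHole →
      EvalE (E.plug (.blame p)) (.blame p)

/-- Evaluation labelled `c`. -/
inductive EvalC {S : Signature} : Term S → Term S → Prop
  | ctx (F : Ctx S false) {M N : Term S} : RedC M N → EvalC (F.plug M) (F.plug N)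

/-- One-step evaluation. -/
def Eval {S : Signature} (M N : Term S) : Prop := EvalE M N ∨ EvalC M N

/-- Multi-step evaluation. -/
def Evals {S : Signature} : Term S → Term S → Prop := Relation.ReflTransGen Eval

/-- There is an infinite evaluation sequence from `M`. -/
def Diverges {S : Signature} (M : Term S) : Prop :=
  ∃ f : ℕ → Term S, f 0 = M ∧ ∀ n, Eval (f n) (f (n + 1))

end LamS

/-! ## The target calculus `λS₁` -/

namespace LamS1

/-- Types `A, B ::= ⋆ | ι | A ⇝ B | A ⇒ B | X`. -/
inductive Ty (S : Signature) : Type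
  | dyn : Ty S
  | base (ι : S.Base) : Ty S
  | crc (A B : Ty S) : Ty S
  | arr (A B : Ty S) : Ty S
  | tvar (X : ℕ) : Ty S

/-- Ground types `G, H ::= ι | ⋆ ⇒ ⋆`. -/
inductive Ground (S : Signature) : Type
  | base (ι : S.Base) : Ground S
  | arr : Ground S

/-- Raw coercions: `id_A`, `g ; G!`, `G?ᵖ ; i`, `s ⇒ t`, `⊥^{GpH}`. The space-efficient ones are
singled out by the same grammar as in `λS`. -/
inductive Crc (S : Signature) : Type
  | id (A : Ty S) : Crc S
  | inj (g : Crc S) (G : Ground S) : Crc S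
  | proj (G : Ground S) (p : S.Label) (i : Crc S) : Crc S
  | arr (s t : Crc S) : Crc S
  | fail (G : Ground S) (p : S.Label) (H : Ground S) : Crc S

/-- The delayed coercions `d ::= g ; G! | s ⇒ t` among the space-efficient ones. -/
inductive IsDelayed {S : Signature} : Crc S → Prop
  | inj (g : Crc S) (G : Ground S) : IsDelayed (.inj g G)
  | arr (s t : Crc S) : IsDelayed (.arr s t)

/-- `s ⇒ t`, except that `id_A ⇒ id_B` is normalized to `id_{A ⇒ B}`. -/
def Crc.mkArr {S : Signature} : Crc S → Crc S → Crc S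
  | .id A, .id B => .id (.arr A B)
  | s, t => .arr s t

open Classical in
/-- Coercion composition `s ⨟ t`, a partial function (`none` when no rule applies). -/
noncomputable def Crc.comp {S : Signature} : Crc S → Crc S → Option (Crc S)
  | .id .dyn, t => some t
  | .proj G p i, t => (Crc.comp i t).map (Crc.proj G p)
  | .inj g G, .id .dyn => some (.inj g G)
  | .inj g G, .proj H p i => if G = H then Crc.comp g i else some (.fail G p H)
  | .fail G p H, _ => some (.fail G p H)
  | .id _, .fail G p H => some (.fail G p H)
  | .arr _ _, .fail G p H => some (.fail G p H)
  | .id A, .inj h H => (Crc.comp (.id A) h).map (fun c => Crc.inj c H)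
  | .arr s t, .inj h H => (Crc.comp (.arr s t) h).map (fun c => Crc.inj c H)
  | .id _, .id B => if B = .dyn then none else some (.id B)
  | .id _, .arr s t => some (.arr s t)
  | .arr s t, .id B => if B = .dyn then none else some (.arr s t)
  | .arr s t, .arr s' t' =>
      (Crc.comp s' s).bind fun u => (Crc.comp t t').map fun v => Crc.mkArr u v
  | _, _ => none
termination_by s t => sizeOf s + sizeOf t

/-- Terms, in de Bruijn notation (index `0` is the innermost binder). `lam M` is `λ(x,κ).M` and
binds two variables, `κ` with index `0` and `x` with index `1`; `letIn M N` is `let x = M in N`;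
`coe s` is the first-class coercion `s`; `app L M N` is `L (M, N)`; `cmp M N` is `M ;; N`;
`crc M N` is `M⟨N⟩`; `crcV U d` is `U⟪d⟫`. -/
inductive Term (S : Signature) : Type
  | var (n : ℕ) : Term S
  | const (a : S.Const) : Term S
  | lam (M : Term S) : Term S
  | coe (s : Crc S) : Term S
  | crcV (U : Term S) (d : Crc S) : Term S
  | op (o : S.Op) (M N : Term S) : Term S
  | app (L M N : Term S) : Term S
  | letIn (M N : Term S) : Term S
  | cmp (M N : Term S) : Term S
  | crc (M N : Term S) : Term S
  | blame (p : S.Label) : Term S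

/-- Uncoerced values `U ::= a | λ(x,κ).M | s`. -/
inductive IsUncoerced {S : Signature} : Term S → Prop
  | const (a : S.Const) : IsUncoerced (.const a)
  | lam (M : Term S) : IsUncoerced (.lam M)
  | coe (s : Crc S) : IsUncoerced (.coe s)

/-- Values `V ::= x | U | U⟪d⟫`. -/
inductive IsValue {S : Signature} : Term S → Prop
  | var (n : ℕ) : IsValue (.var n)
  | unc {U : Term S} : IsUncoerced U → IsValue U
  | crcV {U : Term S} {d : Crc S} : IsUncoerced U → IsDelayed d → IsValue (.crcV U d)

/-- Extension of a renaming under one binder. -/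
def upRen (ξ : ℕ → ℕ) : ℕ → ℕ
  | 0 => 0
  | n + 1 => ξ n + 1

def Term.rename {S : Signature} (ξ : ℕ → ℕ) : Term S → Term S
  | .var n => .var (ξ n)
  | .const a => .const a
  | .lam M => .lam (M.rename (upRen (upRen ξ)))
  | .coe s => .coe s
  | .crcV U d => .crcV (U.rename ξ) d
  | .op o M N => .op o (M.rename ξ) (N.rename ξ)
  | .app L M N => .app (L.rename ξ) (M.rename ξ) (N.rename ξ)
  | .letIn M N => .letIn (M.rename ξ) (N.rename (upRen ξ))
  | .cmp M N => .cmp (M.rename ξ) (N.rename ξ)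
  | .crc M N => .crc (M.rename ξ) (N.rename ξ)
  | .blame p => .blame p

/-- Extension of a substitution under one binder. -/
def upSub {S : Signature} (σ : ℕ → Term S) : ℕ → Term S
  | 0 => .var 0
  | n + 1 => (σ n).rename Nat.succ

/-- Capture-avoiding simultaneous substitution. -/
def Term.subst {S : Signature} (σ : ℕ → Term S) : Term S → Term S
  | .var n => σ n
  | .const a => .const a
  | .lam M => .lam (M.subst (upSub (upSub σ)))
  | .coe s => .coe s
  | .crcV U d => .crcV (U.subst σ) d
  | .op o M N => .op o (M.subst σ) (N.subst σ)
  | .app L M N => .app (L.subst σ) (M.subst σ) (N.subst σ)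
  | .letIn M N => .letIn (M.subst σ) (N.subst (upSub σ))
  | .cmp M N => .cmp (M.subst σ) (N.subst σ)
  | .crc M N => .crc (M.subst σ) (N.subst σ)
  | .blame p => .blame p

/-- `M[x := V]` for the variable `x` with index `0`. -/
def Term.subst1 {S : Signature} (M V : Term S) : Term S :=
  M.subst fun n => match n with
    | 0 => V
    | n + 1 => .var n

/-- `M[x := V, κ := W]` for the variables `κ` with index `0` and `x` with index `1`. -/
def Term.subst2 {S : Signature} (M V W : Term S) : Term S :=
  M.subst fun n => match n with
    | 0 => W
    | 1 => V
    | n + 2 => .var n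

/-- Reduction labelled `e`. -/
inductive RedE {S : Signature} : Term S → Term S → Prop
  | op {o : S.Op} {a b c : S.Const} : S.delta o a b = some c →
      RedE (.op o (.const a) (.const b)) (.const c)
  | beta {M V W : Term S} : IsValue V → IsValue W →
      RedE (.app (.lam M) V W) (M.subst2 V W)
  | wrap {U V W : Term S} {s t : Crc S} : IsUncoerced U → IsValue V → IsValue W →
      RedE (.app (.crcV U (.arr s t)) V W)
        (.letIn (.cmp (.coe t) W)
          (.app (U.rename Nat.succ) (.crc (V.rename Nat.succ) (.coe s)) (.var 0)))

/-- Reduction labelled `c`. -/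
inductive RedC {S : Signature} : Term S → Term S → Prop
  | letIn {V M : Term S} : IsValue V → RedC (.letIn V M) (M.subst1 V)
  | cmp {s t u : Crc S} : s.comp t = some u → RedC (.cmp (.coe s) (.coe t)) (.coe u)
  | id {U : Term S} {A : Ty S} : IsUncoerced U → RedC (.crc U (.coe (.id A))) U
  | fail {U : Term S} {G H : Ground S} {p : S.Label} : IsUncoerced U →
      RedC (.crc U (.coe (.fail G p H))) (.blame p)
  | crc {U : Term S} {d : Crc S} : IsUncoerced U → IsDelayed d →
      RedC (.crc U (.coe d)) (.crcV U d)
  | mergeV {U : Term S} {d t : Crc S} : IsUncoerced U → IsDelayed d →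
      RedC (.crc (.crcV U d) (.coe t)) (.crc U (.cmp (.coe d) (.coe t)))

/-- Evaluation contexts, inside-out. -/
inductive Ctx (S : Signature) : Type
  | hole : Ctx S
  | appL (E : Ctx S) (M N : Term S) : Ctx S
  | appM (E : Ctx S) (V : Term S) (hV : IsValue V) (N : Term S) : Ctx S
  | appR (E : Ctx S) (V : Term S) (hV : IsValue V) (W : Term S) (hW : IsValue W) : Ctx S
  | opL (E : Ctx S) (o : S.Op) (M : Term S) : Ctx S
  | opR (E : Ctx S) (o : S.Op) (V : Term S) (hV : IsValue V) : Ctx S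
  | letIn (E : Ctx S) (M : Term S) : Ctx S
  | cmpL (E : Ctx S) (M : Term S) : Ctx S
  | cmpR (E : Ctx S) (V : Term S) (hV : IsValue V) : Ctx S
  | crcL (E : Ctx S) (M : Term S) : Ctx S
  | crcR (E : Ctx S) (V : Term S) (hV : IsValue V) : Ctx S

/-- `ℰ[M]` -/
def Ctx.plug {S : Signature} : Ctx S → Term S → Term S
  | .hole, L => L
  | .appL E M N, L => E.plug (.app L M N)
  | .appM E V _ N, L => E.plug (.app V L N)
  | .appR E V _ W _, L => E.plug (.app V W L)
  | .opL E o M, L => E.plug (.op o L M)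
  | .opR E o V _, L => E.plug (.op o V L)
  | .letIn E M, L => E.plug (.letIn L M)
  | .cmpL E M, L => E.plug (.cmp L M)
  | .cmpR E V _, L => E.plug (.cmp V L)
  | .crcL E M, L => E.plug (.crc L M)
  | .crcR E V _, L => E.plug (.crc V L)

/-- Evaluation labelled `e`. -/
inductive EvalE {S : Signature} : Term S → Term S → Prop
  | ctx (E : Ctx S) {M N : Term S} : RedE M N → EvalE (E.plug M) (E.plug N)
  | abort (E : Ctx S) (p : S.Label) : E ≠ .hole → EvalE (E.plug (.blame p)) (.blame p)

/-- Evaluation labelled `c`. -/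
inductive EvalC {S : Signature} : Term S → Term S → Prop
  | ctx (E : Ctx S) {M N : Term S} : RedC M N → EvalC (E.plug M) (E.plug N)

/-- One-step evaluation. -/
def Eval {S : Signature} (M N : Term S) : Prop := EvalE M N ∨ EvalC M N

/-- Multi-step evaluation. -/
def Evals {S : Signature} : Term S → Term S → Prop := Relation.ReflTransGen Eval

/-- There is an infinite evaluation sequence from `M`. -/
def Diverges {S : Signature} (M : Term S) : Prop :=
  ∃ f : ℕ → Term S, f 0 = M ∧ ∀ n, Eval (f n) (f (n + 1))

end LamS1

/-! ## The translation into coercion-passing style -/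

namespace LamS

/-- Type translation `Ψ(A)`. -/
def Ty.trans {S : Signature} : Ty S → LamS1.Ty S
  | .dyn => .dyn
  | .base ι => .base ι
  | .arr A B => .arr A.trans B.trans

def Ground.trans {S : Signature} : Ground S → LamS1.Ground S
  | .base ι => .base ι
  | .arr => .arr

/-- Coercion translation `Ψ(s)`. -/
def Crc.trans {S : Signature} : Crc S → LamS1.Crc S
  | .id A => .id A.trans
  | .inj g G => .inj g.trans G.trans
  | .proj G p i => .proj G.trans p i.trans
  | .arr s t => .arr s.trans t.trans
  | .fail G p H => .fail G.trans p H.trans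

/-- The index map under `λx` in the source and `λ(x,κ)` in the target. -/
def liftLam (ρ : ℕ → ℕ) : ℕ → ℕ
  | 0 => 1
  | n + 1 => ρ n + 2

mutual

/-- Term translation `𝒞⟦M⟧`, defined on type derivations. The map `ρ` sends the de Bruijn index
of a variable of `M` to its index in the target term. For a value `V` this is the value
translation `Ψ(V)`, for `M⟨s⟩` it is `𝒦⟦M⟧Ψ(s)`, and for all other terms `M` of type `A` it is
`𝒦⟦M⟧id_{Ψ(A)}`. -/
def transC {S : Signature} {Γ : List (Ty S)} {M : Term S} {A : Ty S} (ρ : ℕ → ℕ) :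
    Deriv Γ M A → LamS1.Term S
  | .var n _ => .var (ρ n)
  | .const _ a => .const a
  | .lam D => .lam (transK (liftLam ρ) D (.var 0))
  | .crcV d _ D _ _ _ => .crcV (transC ρ D) d.trans
  | .crc s D _ _ => transK ρ D (.coe s.trans)
  | .op o D₁ D₂ => .crc (.op o (transC ρ D₁) (transC ρ D₂)) (.coe (.id A.trans))
  | .app D₁ D₂ => .app (transC ρ D₁) (transC ρ D₂) (.coe (.id A.trans))
  | .blame _ p _ => .blame p

/-- Term translation `𝒦⟦M⟧K` with the continuation coercion `K`, a variable or a coercion. -/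
def transK {S : Signature} {Γ : List (Ty S)} {M : Term S} {A : Ty S} (ρ : ℕ → ℕ) :
    Deriv Γ M A → LamS1.Term S → LamS1.Term S
  | .var n _, K => .crc (.var (ρ n)) K
  | .const _ a, K => .crc (.const a) K
  | .lam D, K => .crc (.lam (transK (liftLam ρ) D (.var 0))) K
  | .crcV d _ D _ _ _, K => .crc (.crcV (transC ρ D) d.trans) K
  | .op o D₁ D₂, K => .crc (.op o (transC ρ D₁) (transC ρ D₂)) K
  | .app D₁ D₂, K => .app (transC ρ D₁) (transC ρ D₂) K
  | .crc s D _ _, K =>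
      .letIn (.cmp (.coe s.trans) K) (transK (fun n => ρ n + 1) D (.var 0))
  | .blame _ p _, _ => .blame p

end

/-- `𝒦⟦V⟧K = Ψ(V)⟨K⟩` for values `V`. -/
theorem transK_value {S : Signature} {Γ : List (Ty S)} {V : Term S} {A : Ty S} (ρ : ℕ → ℕ)
    (D : Deriv Γ V A) (hV : IsValue V) (K : LamS1.Term S) :
    transK ρ D K = .crc (transC ρ D) K := by
  cases D <;> first | rfl | (exfalso; cases hV; rename_i h; cases h)

/-- `𝒞⟦M⟧ = 𝒦⟦M⟧id_{Ψ(A)}` for `M` of type `A` neither a value nor a coercion application. -/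
theorem transC_other {S : Signature} {Γ : List (Ty S)} {M : Term S} {A : Ty S} (ρ : ℕ → ℕ)
    (D : Deriv Γ M A) (hV : ¬ IsValue M) (hC : ∀ N s, M ≠ .crc N s) :
    transC ρ D = transK ρ D (.coe (.id A.trans)) := by
  cases D with
  | const a => exact absurd (.unc (.const _)) hV
  | var n h => exact absurd (.var _) hV
  | lam D => exact absurd (.unc (.lam _)) hV
  | crcV d hU D hd hd' ht => exact absurd (.crcV hU hd') hV
  | crc s D hs ht => exact absurd rfl (hC _ _)
  | op o D₁ D₂ => rfl
  | app D₁ D₂ => rfl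
  | blame p => rfl

end LamS

-- Coercion composition: totality on matching types and compatibility with the translation

namespace LamS

-- The proof combines a forward simulation with determinism of the target. A source step between
-- closed typed terms is matched by one or more target steps between their translations
-- (`Eval.simulation`). Only an abort may cost no target step, and nothing evaluates after it. Hence
-- constants, blame and divergence all carry over from source to target.
--
-- The converse needs neither a backward simulation nor determinism of the source. By progress and
-- preservation, a closed source term of base type reaches a constant, reaches blame, or diverges
-- (`Deriv.trichotomy`). Each alternative carries over, and in the deterministic target
-- (`LamS1.Eval.deterministic`) the possible outcomes exclude one another. So the outcome observed
-- in the target must come from the same outcome in the source.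
--
-- The simulation rests on three facts. Composition commutes with `Ψ` (`Crc.comp_spec`).
-- Substitution of values commutes with the translation (`Deriv.exists_subst1`). A source context
-- becomes a target context (`Ctx.exists_trans`), where an innermost `□⟨s⟩` gives no frame but is
-- passed to the hole as its continuation: the hole is then translated by `𝒦` at `Ψ(s)`, and
-- otherwise by `𝒞`. Reductions labelled `e` are therefore simulated in both modes, those labelled
-- `c` only under `𝒞`. One mismatch remains: `𝒞` of a contractum need not be `𝒦` at the identity,
-- but the identity continuation can be evaluated away (`steps_transK_id`).
--
-- Since the translation depends on derivations, preservation and simulation are proved together: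
-- each lemma constructs the derivation of the contractum along with the target steps.

theorem Ty.trans_eq_dyn {S : Signature} {A : Ty S} : A.trans = .dyn ↔ A = .dyn := by
  cases A <;> simp [Ty.trans]

theorem Ground.trans_inj {S : Signature} {G H : Ground S} : G.trans = H.trans ↔ G = H := by
  cases G <;> cases H <;> simp [Ground.trans]

theorem Gram.ground_of_inj {S : Signature} {c : Cat} {g : Crc S} {G : Ground S}
    (h : Gram c (.inj g G)) : Gram .ground g := by
  cases h with
  | ofInter h =>
    cases h with
    | inj h => exact h
    | ofGround h => cases h
  | inj h => exact h
  | ofGround h => cases h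

theorem Gram.inter_of_proj {S : Signature} {c : Cat} {i : Crc S} {G : Ground S} {p : S.Label}
    (h : Gram c (.proj G p i)) : Gram .inter i := by
  rcases h with _ | h | h | _ | h
  · exact h
  · rcases h with _ | _ | _ | _ | h
    cases h
  · cases h

theorem Gram.ground_of_arr {S : Signature} {c : Cat} {s t : Crc S}
    (h : Gram c (.arr s t)) : Gram .ground (.arr s t) := by
  rcases h with _ | _ | h | _ | h | _ | _ | ⟨h₁, h₂, h₃⟩
  · rcases h with _ | _ | _ | _ | h
    exact h
  · exact h
  · exact .arr h₁ h₂ h₃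

theorem Gram.space_of_arr {S : Signature} {c : Cat} {s t : Crc S}
    (h : Gram c (.arr s t)) : Gram .space s ∧ Gram .space t := by
  cases h.ground_of_arr with
  | arr h₁ h₂ _ => exact ⟨h₁, h₂⟩

theorem Gram.ne_dyn {S : Signature} {A : Ty S} {c : Cat} (hc : c ≠ .space)
    (h : Gram c (.id A)) : A ≠ .dyn := by
  cases h with
  | idDyn => exact absurd rfl hc
  | ofInter h => exact absurd rfl hc
  | ofGround h => cases h with | id h => exact h
  | id h => exact h

theorem Gram.not_proj {S : Signature} {i : Crc S} {G : Ground S} {p : S.Label} {c : Cat}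
    (hc : c ≠ .space) : ¬ Gram c (.proj G p i) := by
  intro h
  cases h with
  | proj h => exact absurd rfl hc
  | ofInter h => exact absurd rfl hc
  | ofGround h => cases h

theorem Gram.space {S : Signature} {c : Cat} {s : Crc S} (h : Gram c s) : Gram .space s := by
  cases c with
  | space => exact h
  | inter => exact .ofInter h
  | ground => exact .ofInter (.ofGround h)

/-- Intermediate and ground coercions do not start at `⋆`. -/
theorem CrcTy.src_ne_dyn {S : Signature} {c : Cat} (hc : c ≠ .space) {s : Crc S}
    (h : Gram c s) {A B : Ty S} (hs : CrcTy s A B) : A ≠ .dyn := by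
  induction hs generalizing c with
  | id A => exact h.ne_dyn hc
  | inj hg ih => exact ih (by simp) h.ground_of_inj
  | proj hi ih => exact absurd h (Gram.not_proj hc)
  | arr => simp
  | fail hA => exact hA

/-- A ground coercion into a ground type starts at a type consistent with it. -/
theorem CrcTy.consistent_of_ground {S : Signature} {g : Crc S} {A B : Ty S} (h : Gram .ground g)
    (hg : CrcTy g A B) {G : Ground S} (hB : Consistent B G.toTy) : Consistent A G.toTy := by
  cases h with
  | id hA => cases hg; exact hB
  | arr h₁ h₂ h₃ =>
    cases hg
    cases G with
    | base ι => cases hB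
    | arr => exact .arr (.dynR _) (.dynR _)

theorem Ground.consistent_self {S : Signature} (G : Ground S) : Consistent G.toTy G.toTy := by
  cases G with
  | base ι => exact .base ι
  | arr => exact .arr (.dynR _) (.dynR _)

theorem Crc.trans_mkArr {S : Signature} (s t : Crc S) :
    (Crc.mkArr s t).trans = LamS1.Crc.mkArr s.trans t.trans := by
  cases s <;> cases t <;> rfl

/-- Collapsing `id → id` is what secures the side condition that the two components are not both
identities. -/
theorem Gram.mkArr {S : Signature} {s t : Crc S} (hs : Gram .space s) (ht : Gram .space t) :
    Gram .ground (Crc.mkArr s t) := by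
  cases s <;> cases t <;>
    first
    | exact .id (by simp)
    | (refine .arr hs ht (.inl ?_); simp [Crc.IsId]; done)
    | (refine .arr hs ht (.inr ?_); simp [Crc.IsId]; done)

theorem CrcTy.mkArr {S : Signature} {s t : Crc S} {A A' B B' : Ty S} (hs : CrcTy s A' A)
    (ht : CrcTy t B B') : CrcTy (Crc.mkArr s t) (.arr A B) (.arr A' B') := by
  cases s <;> cases t <;> first
    | exact .arr hs ht
    | (cases hs; cases ht; exact .id _)

/-- Composition of matching coercions is defined, stays in the grammar, is well typed and commutes
with the translation. -/
theorem Crc.comp_spec {S : Signature} (s t : Crc S) {A B C : Ty S} (gs : Gram .space s)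
    (gt : Gram .space t) (hs : CrcTy s A B) (ht : CrcTy t B C) :
    ∃ u, s.comp t = some u ∧ Gram .space u ∧ CrcTy u A C ∧
      s.trans.comp t.trans = some u.trans ∧ (Gram .inter s → Gram .inter u) ∧
      (Gram .ground s → Gram .ground t → Gram .ground u) := by
  match s, hs with
  | .id A, .id _ =>
    by_cases hA : A = .dyn
    · subst hA
      refine ⟨t, by simp [Crc.comp], gt, ht, by simp [Crc.trans, Ty.trans, LamS1.Crc.comp],
        fun h => absurd rfl (h.ne_dyn (by simp)), fun h => absurd rfl (h.ne_dyn (by simp))⟩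
    have hA' : A.trans ≠ .dyn := fun h => hA (Ty.trans_eq_dyn.1 h)
    match t, ht with
    | .id _, .id _ =>
      exact ⟨.id A, by simp [Crc.comp, hA], gs, .id _, by simp [Crc.trans, LamS1.Crc.comp, hA'],
        fun h => h, fun h _ => h⟩
    | .arr _ _, .arr h₁ h₂ =>
      exact ⟨_, by simp [Crc.comp], gt, .arr h₁ h₂, by simp [Crc.trans, LamS1.Crc.comp, Ty.trans],
        fun _ => .ofGround gt.ground_of_arr, fun _ h => h⟩
    | .fail G p H, .fail h₁ h₂ h₃ =>
      exact ⟨.fail G p H, by simp [Crc.comp], gt, .fail h₁ h₂ h₃,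
        by simp [Crc.trans, LamS1.Crc.comp], fun _ => .fail, fun _ h => h⟩
    | .proj .., .proj _ => exact absurd rfl hA
    | .inj h H, .inj hh =>
      -- `u; H!` lies in the grammar only if `u` is ground; hence the clause on ground coercions in
      -- the induction.
      obtain ⟨u, e, -, hu, et, -, gu⟩ := Crc.comp_spec (.id A) h gs gt.ground_of_inj.space
        (.id A) hh
      have gu' := gu (.id hA) gt.ground_of_inj
      refine ⟨.inj u H, ?_, .ofInter (.inj gu'), .inj hu, ?_, fun _ => .inj gu', ?_⟩
      · simp [Crc.comp, e]
      · simp [Crc.trans] at et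
        simp [Crc.trans, LamS1.Crc.comp, et]
      · intro _ h; cases h
  | .proj G p i, .proj hi =>
    -- Here the tail `u` of the projection must be intermediate; hence the clause on intermediate
    -- coercions.
    obtain ⟨u, e, -, hu, et, gu, -⟩ := Crc.comp_spec i t gs.inter_of_proj.space gt hi ht
    refine ⟨.proj G p u, by simp [Crc.comp, e], .proj (gu gs.inter_of_proj), .proj hu,
      by simp [Crc.trans, LamS1.Crc.comp, et], fun h => absurd h (Gram.not_proj (by simp)),
      fun h => absurd h (Gram.not_proj (by simp))⟩
  | .inj g G, .inj hg =>
    match t, ht with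
    | .id _, .id _ =>
      exact ⟨.inj g G, by simp [Crc.comp], gs, .inj hg,
        by simp [Crc.trans, LamS1.Crc.comp, Ty.trans], fun h => h, fun h => by cases h⟩
    | .proj H p i, .proj hi =>
      by_cases hGH : G = H
      · subst hGH
        obtain ⟨u, e, gu', hu, et, gu, -⟩ := Crc.comp_spec g i gs.ground_of_inj.space
          gt.inter_of_proj.space hg hi
        exact ⟨u, by simp [Crc.comp, e], gu', hu, by simp [Crc.trans, LamS1.Crc.comp, et],
          fun _ => gu (.ofGround gs.ground_of_inj), fun h => by cases h⟩
      · exact ⟨.fail G p H, by simp [Crc.comp, hGH], .ofInter .fail,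
          .fail (CrcTy.src_ne_dyn (by simp) gs.ground_of_inj hg)
            (CrcTy.consistent_of_ground gs.ground_of_inj hg G.consistent_self) hGH,
          by simp [Crc.trans, LamS1.Crc.comp, Ground.trans_inj, hGH], fun _ => .fail,
          fun h => by cases h⟩
    | .inj h H, .inj hh =>
      exact absurd rfl (CrcTy.src_ne_dyn (by simp) gt.ground_of_inj hh)
    | .fail .., .fail h₁ _ _ => exact absurd rfl h₁
  | .fail G p H, .fail h₁ h₂ h₃ =>
    exact ⟨.fail G p H, by simp [Crc.comp], gs, .fail h₁ h₂ h₃,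
      by simp [Crc.trans, LamS1.Crc.comp], fun h => h, fun h => by cases h⟩
  | .arr s₁ s₂, .arr hs₁ hs₂ =>
    match t, ht with
    | .id _, .id _ =>
      exact ⟨.arr s₁ s₂, by simp [Crc.comp], gs, .arr hs₁ hs₂,
        by simp [Crc.trans, LamS1.Crc.comp, Ty.trans], fun h => h, fun h _ => h⟩
    | .arr t₁ t₂, .arr ht₁ ht₂ =>
      -- Contravariance swaps the two arguments, so the recursion is on the sum of their sizes.
      obtain ⟨u, e, gu, hu, et, -⟩ := Crc.comp_spec t₁ s₁ gt.space_of_arr.1 gs.space_of_arr.1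
        ht₁ hs₁
      obtain ⟨v, e', gv, hv, et', -⟩ := Crc.comp_spec s₂ t₂ gs.space_of_arr.2 gt.space_of_arr.2
        hs₂ ht₂
      exact ⟨Crc.mkArr u v, by simp [Crc.comp, e, e'], (Gram.mkArr gu gv).space, hu.mkArr hv,
        by simp [Crc.trans, LamS1.Crc.comp, et, et', Crc.trans_mkArr],
        fun _ => .ofGround (Gram.mkArr gu gv), fun _ _ => Gram.mkArr gu gv⟩
    | .fail G p H, .fail h₁ h₂ h₃ =>
      exact ⟨.fail G p H, by simp [Crc.comp], gt, .fail (by simp)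
        (CrcTy.consistent_of_ground gs.ground_of_arr (.arr hs₁ hs₂) h₂) h₃,
        by simp [Crc.trans, LamS1.Crc.comp], fun _ => .fail, fun _ h => h⟩
    | .inj h H, .inj hh =>
      obtain ⟨u, e, -, hu, et, -, gu⟩ := Crc.comp_spec (.arr s₁ s₂) h gs gt.ground_of_inj.space
        (.arr hs₁ hs₂) hh
      have gu' := gu gs.ground_of_arr gt.ground_of_inj
      refine ⟨.inj u H, ?_, .ofInter (.inj gu'), .inj hu, ?_, fun _ => .inj gu', ?_⟩
      · simp [Crc.comp, e]
      · simp [Crc.trans] at et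
        simp [Crc.trans, LamS1.Crc.comp, et]
      · intro _ h; cases h
termination_by sizeOf s + sizeOf t
decreasing_by all_goals simp_wf; try omega

/-- The right unit law, which disposes of the identity continuations inserted by the translation. -/
theorem Crc.trans_comp_id {S : Signature} {s : Crc S} {A B : Ty S} (hs : CrcTy s A B) :
    s.trans.comp (.id B.trans) = some s.trans := by
  induction hs with
  | id A =>
    by_cases hA : A = .dyn
    · simp [Crc.trans, hA, Ty.trans, LamS1.Crc.comp]
    · simp [Crc.trans, LamS1.Crc.comp, Ty.trans_eq_dyn, hA]
  | inj => simp [Crc.trans, LamS1.Crc.comp, Ty.trans]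
  | proj _ ih => simp [Crc.trans, LamS1.Crc.comp, ih]
  | arr => simp [Crc.trans, LamS1.Crc.comp, Ty.trans]
  | fail => simp [Crc.trans, LamS1.Crc.comp]

end LamS

-- Determinism of the target calculus

namespace LamS1

/-- The subterm of a term in the position where evaluation takes place. -/
noncomputable def Term.active {S : Signature} : Term S → Term S
  | .op o M N =>
      open Classical in
      if ¬ IsValue M then M.active else if ¬ IsValue N then N.active else .op o M N
  | .app L M N =>
      open Classical in
      if ¬ IsValue L then L.active else if ¬ IsValue M then M.active
      else if ¬ IsValue N then N.active else .app L M N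
  | .letIn M N => open Classical in if ¬ IsValue M then M.active else .letIn M N
  | .cmp M N =>
      open Classical in
      if ¬ IsValue M then M.active else if ¬ IsValue N then N.active else .cmp M N
  | .crc M N =>
      open Classical in
      if ¬ IsValue M then M.active else if ¬ IsValue N then N.active else .crc M N
  | M => M

/-- The result of replacing the active subterm of a term by `R`. -/
noncomputable def Term.update {S : Signature} : Term S → Term S → Term S
  | .op o M N, R =>
      open Classical in
      if ¬ IsValue M then .op o (M.update R) N
      else if ¬ IsValue N then .op o M (N.update R) else R
  | .app L M N, R =>
      open Classical in
      if ¬ IsValue L then .app (L.update R) M N else if ¬ IsValue M then .app L (M.update R) N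
      else if ¬ IsValue N then .app L M (N.update R) else R
  | .letIn M N, R => open Classical in if ¬ IsValue M then .letIn (M.update R) N else R
  | .cmp M N, R =>
      open Classical in
      if ¬ IsValue M then .cmp (M.update R) N
      else if ¬ IsValue N then .cmp M (N.update R) else R
  | .crc M N, R =>
      open Classical in
      if ¬ IsValue M then .crc (M.update R) N
      else if ¬ IsValue N then .crc M (N.update R) else R
  | _, R => R

theorem not_isValue_op {S : Signature} {o : S.Op} {M N : Term S} : ¬ IsValue (.op o M N) := by
  intro h; cases h with | unc h => cases h

theorem not_isValue_app {S : Signature} {L M N : Term S} : ¬ IsValue (.app L M N) := by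
  intro h; cases h with | unc h => cases h

theorem not_isValue_letIn {S : Signature} {M N : Term S} : ¬ IsValue (.letIn M N) := by
  intro h; cases h with | unc h => cases h

theorem not_isValue_cmp {S : Signature} {M N : Term S} : ¬ IsValue (.cmp M N) := by
  intro h; cases h with | unc h => cases h

theorem not_isValue_crc {S : Signature} {M N : Term S} : ¬ IsValue (.crc M N) := by
  intro h; cases h with | unc h => cases h

theorem not_isValue_blame {S : Signature} {p : S.Label} : ¬ IsValue (.blame p) := by
  intro h; cases h with | unc h => cases h

theorem isValue_coe {S : Signature} {s : Crc S} : IsValue (.coe s) := .unc (.coe s)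

/-- Contexts are inside-out, so the induction absorbs the innermost frame into the plugged term,
which stays a non-value. Frames demand values exactly where `active` looks past them. -/
theorem Ctx.plug_spec {S : Signature} (E : Ctx S) {M : Term S} (hM : ¬ IsValue M) (R : Term S) :
    ¬ IsValue (E.plug M) ∧ (E.plug M).active = M.active ∧
      (E.plug M).update R = E.plug (M.update R) := by
  induction E generalizing M with
  | hole => exact ⟨hM, rfl, rfl⟩
  | appL E N₁ N₂ ih =>
    simpa [plug, Term.active, Term.update, hM] using @ih (.app M N₁ N₂) not_isValue_app
  | appM E V hV N ih =>
    simpa [plug, Term.active, Term.update, hM, hV] using @ih (.app V M N) not_isValue_app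
  | appR E V hV W hW ih =>
    simpa [plug, Term.active, Term.update, hM, hV, hW] using @ih (.app V W M) not_isValue_app
  | opL E o N ih =>
    simpa [plug, Term.active, Term.update, hM] using @ih (.op o M N) not_isValue_op
  | opR E o V hV ih =>
    simpa [plug, Term.active, Term.update, hM, hV] using @ih (.op o V M) not_isValue_op
  | letIn E N ih =>
    simpa [plug, Term.active, Term.update, hM] using @ih (.letIn M N) not_isValue_letIn
  | cmpL E N ih =>
    simpa [plug, Term.active, Term.update, hM] using @ih (.cmp M N) not_isValue_cmp
  | cmpR E V hV ih =>
    simpa [plug, Term.active, Term.update, hM, hV] using @ih (.cmp V M) not_isValue_cmp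
  | crcL E N ih =>
    simpa [plug, Term.active, Term.update, hM] using @ih (.crc M N) not_isValue_crc
  | crcR E V hV ih =>
    simpa [plug, Term.active, Term.update, hM, hV] using @ih (.crc V M) not_isValue_crc

/-- Reduction at the root. -/
def Red {S : Signature} (M N : Term S) : Prop := RedE M N ∨ RedC M N

theorem IsUncoerced.isValue {S : Signature} {U : Term S} (h : IsUncoerced U) : IsValue U := .unc h

theorem Red.active {S : Signature} {M N : Term S} (h : Red M N) (R : Term S) :
    ¬ IsValue M ∧ M.active = M ∧ M.update R = R := by
  have hc : ∀ a : S.Const, IsValue (.const a) := fun a => .unc (.const a)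
  have hl : ∀ M : Term S, IsValue (.lam M) := fun M => .unc (.lam M)
  have hk : ∀ s : Crc S, IsValue (.coe s) := fun s => .unc (.coe s)
  rcases h with h | h
  · cases h with
    | op h => simp [Term.active, Term.update, hc, not_isValue_op]
    | beta h₁ h₂ => simp [Term.active, Term.update, hl, h₁, h₂, not_isValue_app]
    | wrap hU h₁ h₂ =>
      simp [Term.active, Term.update, IsValue.crcV hU (.arr _ _), h₁, h₂, not_isValue_app]
  · cases h with
    | letIn h => simp [Term.active, Term.update, h, not_isValue_letIn]
    | cmp h => simp [Term.active, Term.update, hk, not_isValue_cmp]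
    | id h => simp [Term.active, Term.update, hk, h.isValue, not_isValue_crc]
    | fail h => simp [Term.active, Term.update, hk, h.isValue, not_isValue_crc]
    | crc h => simp [Term.active, Term.update, hk, h.isValue, not_isValue_crc]
    | mergeV h h' => simp [Term.active, Term.update, hk, IsValue.crcV h h', not_isValue_crc]

theorem RedE.deterministic {S : Signature} {M M' N N' : Term S} (h : RedE M N) (h' : RedE M' N')
    (e : M = M') : N = N' := by
  cases h <;> cases h' <;> cases e
  case op.op => simp_all
  all_goals rfl

theorem RedC.deterministic {S : Signature} {M M' N N' : Term S} (h : RedC M N) (h' : RedC M' N')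
    (e : M = M') : N = N' := by
  cases h <;> cases h' <;> cases e
  case cmp.cmp => simp_all
  -- Distinct rules for coercion application never overlap: the shapes of the coercions differ, or a
  -- coerced value would have to be uncoerced.
  all_goals first
    | rfl
    | (rename_i h; cases h; done)
    | (rename_i h _; cases h)

theorem Red.deterministic {S : Signature} {M N N' : Term S} (h : Red M N) (h' : Red M N') :
    N = N' := by
  rcases h with h | h <;> rcases h' with h' | h'
  · exact h.deterministic h' rfl
  · cases h <;> cases h'
  · cases h <;> cases h'
  · exact h.deterministic h' rfl

theorem Red.not_blame {S : Signature} {p : S.Label} {N : Term S} : ¬ Red (.blame p) N := by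
  rintro (h | h) <;> cases h

/-- Eliminates the choice of context: a step is determined by what happens at the active subterm, so
determinism reduces to reduction at the root. -/
theorem Eval.cases_active {S : Signature} {M N : Term S} (h : Eval M N) :
    ¬ IsValue M ∧ ((∃ p, M.active = .blame p ∧ N = .blame p) ∨
      ∃ R, Red M.active R ∧ N = M.update R) := by
  have key : ∀ (E : Ctx S) {P R : Term S}, Red P R → ¬ IsValue (E.plug P) ∧
      Red (E.plug P).active R ∧ E.plug R = (E.plug P).update R := by
    intro E P R hr
    obtain ⟨h₁, h₂, h₃⟩ := hr.active R
    obtain ⟨h₄, h₅, h₆⟩ := E.plug_spec h₁ R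
    rw [h₅, h₂, h₆, h₃]
    exact ⟨h₄, hr, rfl⟩
  rcases h with (⟨E, hr⟩ | ⟨E, p, -⟩) | ⟨E, hr⟩
  · exact ⟨(key E (.inl hr)).1, .inr ⟨_, (key E (.inl hr)).2⟩⟩
  · obtain ⟨h₁, h₂, -⟩ := E.plug_spec (not_isValue_blame (p := p)) (.blame p)
    exact ⟨h₁, .inl ⟨p, h₂, rfl⟩⟩
  · exact ⟨(key E (.inr hr)).1, .inr ⟨_, (key E (.inr hr)).2⟩⟩

theorem Eval.deterministic {S : Signature} {M N N' : Term S} (h : Eval M N) (h' : Eval M N') :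
    N = N' := by
  rcases h.cases_active.2 with ⟨p, hp, rfl⟩ | ⟨R, hR, rfl⟩ <;>
    rcases h'.cases_active.2 with ⟨p', hp', rfl⟩ | ⟨R', hR', rfl⟩
  · rw [← hp, hp']
  · rw [hp] at hR'; exact absurd hR' Red.not_blame
  · rw [hp'] at hR; exact absurd hR Red.not_blame
  · rw [hR.deterministic hR']

theorem Ctx.plug_eq_blame {S : Signature} {E : Ctx S} {M : Term S} {p : S.Label}
    (h : E.plug M = .blame p) : E = .hole ∧ M = .blame p := by
  induction E generalizing M with
  | hole => exact ⟨rfl, h⟩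
  | _ => rename_i ih; cases (ih h).2

theorem not_eval_blame {S : Signature} {p : S.Label} {N : Term S} : ¬ Eval (.blame p) N := by
  intro h
  generalize hM : Term.blame p = M at h
  rcases h with (⟨E, hr⟩ | ⟨E, q, hE⟩) | ⟨E, hr⟩
  · rw [(Ctx.plug_eq_blame hM.symm).2] at hr; cases hr
  · exact hE (Ctx.plug_eq_blame hM.symm).1
  · rw [(Ctx.plug_eq_blame hM.symm).2] at hr; cases hr

theorem not_eval_const {S : Signature} {a : S.Const} {N : Term S} : ¬ Eval (.const a) N :=
  fun h => h.cases_active.1 (.unc (.const a))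

-- Reduction sequences valid in every target context

/-- `M` reduces to `N` in zero or more steps in every context. -/
def Steps {S : Signature} (M N : Term S) : Prop := ∀ E : Ctx S, Evals (E.plug M) (E.plug N)

/-- `M` reduces to `N` in one or more steps in every context. -/
def Steps₁ {S : Signature} (M N : Term S) : Prop :=
  ∀ E : Ctx S, Relation.TransGen Eval (E.plug M) (E.plug N)

theorem Steps.refl {S : Signature} (M : Term S) : Steps M M := fun _ => .refl

theorem Steps₁.steps {S : Signature} {M N : Term S} (h : Steps₁ M N) : Steps M N :=
  fun E => (h E).to_reflTransGen

theorem Steps₁.trans_left {S : Signature} {L M N : Term S} (h : Steps₁ L M) (h' : Steps M N) :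
    Steps₁ L N := fun E => (h E).trans_left (h' E)

theorem Steps₁.trans {S : Signature} {L M N : Term S} (h : Steps₁ L M) (h' : Steps₁ M N) :
    Steps₁ L N := h.trans_left h'.steps

theorem Red.steps {S : Signature} {M N : Term S} (h : Red M N) : Steps₁ M N := fun E =>
  .single (h.elim (fun h => .inl (.ctx E h)) fun h => .inr (.ctx E h))

theorem RedC.steps {S : Signature} {M N : Term S} (h : RedC M N) : Steps₁ M N :=
  Red.steps (.inr h)

theorem RedE.steps {S : Signature} {M N : Term S} (h : RedE M N) : Steps₁ M N :=
  Red.steps (.inl h)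

/-- `let x = s ;; t in M` evaluates to `M[x := s ⨟ t]`. -/
theorem steps_letIn_cmp {S : Signature} {s t u : Crc S} (h : s.comp t = some u) (M : Term S) :
    Steps₁ (.letIn (.cmp (.coe s) (.coe t)) M) (M.subst1 (.coe u)) :=
  Steps₁.trans (fun E => (RedC.cmp h).steps (.letIn E M)) (RedC.letIn isValue_coe).steps

theorem steps_crcV_crc {S : Signature} {U : Term S} {d t u : Crc S} (hU : IsUncoerced U)
    (hd : IsDelayed d) (h : d.comp t = some u) :
    Steps₁ (.crc (.crcV U d) (.coe t)) (.crc U (.coe u)) :=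
  (RedC.mergeV hU hd).steps.trans fun E => (RedC.cmp h).steps (.crcR E U hU.isValue)

end LamS1

namespace LamS

/-! ### The translation under renaming and substitution -/

theorem trans_rename {S : Signature} {Γ : List (Ty S)} {M : Term S} {A : Ty S} (D : Deriv Γ M A) :
    ∀ ρ ρ' ξ : ℕ → ℕ, (∀ n, ξ (ρ n) = ρ' n) →
      (transC ρ D).rename ξ = transC ρ' D ∧
      ∀ K, (transK ρ D K).rename ξ = transK ρ' D (K.rename ξ) := by
  induction D with
  | const Γ a => intros; exact ⟨rfl, fun _ => rfl⟩
  | blame Γ p A => intros; exact ⟨rfl, fun _ => rfl⟩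
  | var n h => intro ρ ρ' ξ hξ; simp [transC, transK, LamS1.Term.rename, hξ]
  | op o D₁ D₂ ih₁ ih₂ =>
    intro ρ ρ' ξ hξ
    simp [transC, transK, LamS1.Term.rename, (ih₁ ρ ρ' ξ hξ).1, (ih₂ ρ ρ' ξ hξ).1]
  | app D₁ D₂ ih₁ ih₂ =>
    intro ρ ρ' ξ hξ
    simp [transC, transK, LamS1.Term.rename, (ih₁ ρ ρ' ξ hξ).1, (ih₂ ρ ρ' ξ hξ).1]
  | crcV d hU D hd hd' ht ih =>
    intro ρ ρ' ξ hξ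
    simp [transC, transK, LamS1.Term.rename, (ih ρ ρ' ξ hξ).1]
  | lam D ih =>
    intro ρ ρ' ξ hξ
    have h := (ih (liftLam ρ) (liftLam ρ') (LamS1.upRen (LamS1.upRen ξ)) (by
      rintro (_ | n) <;> simp [liftLam, LamS1.upRen, hξ])).2
    simp [transC, transK, LamS1.Term.rename, h, LamS1.upRen]
  | crc s D hs ht ih =>
    intro ρ ρ' ξ hξ
    have h := (ih (fun n => ρ n + 1) (fun n => ρ' n + 1) (LamS1.upRen ξ) (by
      intro n; simp [LamS1.upRen, hξ])).2
    simp [transC, transK, LamS1.Term.rename, h, LamS1.upRen, (ih ρ ρ' ξ hξ).2]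

/-- `τ` is constrained only on the range of `ρ`, so an index outside it, such as that of a let-bound
continuation, may receive any term. -/
theorem trans_subst_var {S : Signature} {Γ : List (Ty S)} {M : Term S} {A : Ty S}
    (D : Deriv Γ M A) :
    ∀ (ρ ρ' : ℕ → ℕ) (τ : ℕ → LamS1.Term S), (∀ n, τ (ρ n) = .var (ρ' n)) →
      (transC ρ D).subst τ = transC ρ' D ∧
      ∀ K, (transK ρ D K).subst τ = transK ρ' D (K.subst τ) := by
  induction D with
  | const Γ a => intros; exact ⟨rfl, fun _ => rfl⟩
  | blame Γ p A => intros; exact ⟨rfl, fun _ => rfl⟩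
  | var n h => intro ρ ρ' τ hτ; simp [transC, transK, LamS1.Term.subst, hτ]
  | op o D₁ D₂ ih₁ ih₂ =>
    intro ρ ρ' τ hτ
    simp [transC, transK, LamS1.Term.subst, (ih₁ ρ ρ' τ hτ).1, (ih₂ ρ ρ' τ hτ).1]
  | app D₁ D₂ ih₁ ih₂ =>
    intro ρ ρ' τ hτ
    simp [transC, transK, LamS1.Term.subst, (ih₁ ρ ρ' τ hτ).1, (ih₂ ρ ρ' τ hτ).1]
  | crcV d hU D hd hd' ht ih =>
    intro ρ ρ' τ hτ
    simp [transC, transK, LamS1.Term.subst, (ih ρ ρ' τ hτ).1]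
  | lam D ih =>
    intro ρ ρ' τ hτ
    have h := (ih (liftLam ρ) (liftLam ρ') (LamS1.upSub (LamS1.upSub τ)) (by
      rintro (_ | n) <;> simp [liftLam, LamS1.upSub, LamS1.Term.rename, hτ])).2
    simp [transC, transK, LamS1.Term.subst, h, LamS1.upSub]
  | crc s D hs ht ih =>
    intro ρ ρ' τ hτ
    have h := (ih (fun n => ρ n + 1) (fun n => ρ' n + 1) (LamS1.upSub τ) (by
      intro n; simp [LamS1.upSub, LamS1.Term.rename, hτ])).2
    simp [transC, transK, LamS1.Term.subst, h, LamS1.upSub, (ih ρ ρ' τ hτ).2]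

theorem transK_subst1 {S : Signature} {Γ : List (Ty S)} {M : Term S} {A : Ty S}
    (D : Deriv Γ M A) (K : LamS1.Term S) :
    (transK (fun n => id n + 1) D (.var 0)).subst1 K = transK id D K :=
  (trans_subst_var D (fun n => id n + 1) id _ (fun _ => rfl)).2 (.var 0)

theorem IsUncoerced.rename {S : Signature} {U : Term S} (h : IsUncoerced U) (ξ : ℕ → ℕ) :
    IsUncoerced (U.rename ξ) := by
  cases h <;> constructor

theorem IsUncoerced.subst {S : Signature} {U : Term S} (h : IsUncoerced U) (σ : ℕ → Term S) :
    IsUncoerced (U.subst σ) := by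
  cases h <;> constructor

theorem IsUncoerced.isValue {S : Signature} {U : Term S} (h : IsUncoerced U) : IsValue U := .unc h

theorem IsValue.rename {S : Signature} {V : Term S} (h : IsValue V) (ξ : ℕ → ℕ) :
    IsValue (V.rename ξ) := by
  cases h with
  | var => exact .var _
  | unc h => exact (h.rename ξ).isValue
  | crcV h hd => exact .crcV (h.rename ξ) hd

/-- The translation reads the derivation, so weakening has to produce a derivation with a controlled
translation, not just typability. -/
theorem Deriv.exists_rename {S : Signature} {Γ : List (Ty S)} {M : Term S} {A : Ty S}
    (D : Deriv Γ M A) :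
    ∀ (Δ : List (Ty S)) (ξ : ℕ → ℕ), (∀ (n : ℕ) (B : Ty S), Γ[n]? = some B → Δ[ξ n]? = some B) →
      ∃ D' : Deriv Δ (M.rename ξ) A, ∀ ρ : ℕ → ℕ, transC ρ D' = transC (fun n => ρ (ξ n)) D ∧
        ∀ K, transK ρ D' K = transK (fun n => ρ (ξ n)) D K := by
  induction D with
  | const Γ a => intro Δ ξ _; exact ⟨.const Δ a, fun _ => ⟨rfl, fun _ => rfl⟩⟩
  | blame Γ p A => intro Δ ξ _; exact ⟨.blame Δ p A, fun _ => ⟨rfl, fun _ => rfl⟩⟩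
  | var n h => intro Δ ξ hξ; exact ⟨.var _ (hξ n _ h), fun _ => ⟨rfl, fun _ => rfl⟩⟩
  | op o D₁ D₂ ih₁ ih₂ =>
    intro Δ ξ hξ
    obtain ⟨E₁, h₁⟩ := ih₁ Δ ξ hξ
    obtain ⟨E₂, h₂⟩ := ih₂ Δ ξ hξ
    exact ⟨.op o E₁ E₂, fun ρ => by simp [transC, transK, (h₁ ρ).1, (h₂ ρ).1]⟩
  | app D₁ D₂ ih₁ ih₂ =>
    intro Δ ξ hξ
    obtain ⟨E₁, h₁⟩ := ih₁ Δ ξ hξ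
    obtain ⟨E₂, h₂⟩ := ih₂ Δ ξ hξ
    exact ⟨.app E₁ E₂, fun ρ => by simp [transC, transK, (h₁ ρ).1, (h₂ ρ).1]⟩
  | crcV d hU D hd hd' ht ih =>
    intro Δ ξ hξ
    obtain ⟨E, h⟩ := ih Δ ξ hξ
    exact ⟨.crcV d (hU.rename ξ) E hd hd' ht, fun ρ => by simp [transC, transK, (h ρ).1]⟩
  | @lam Γ M A B D ih =>
    intro Δ ξ hξ
    obtain ⟨E, h⟩ := ih (A :: Δ) (upRen ξ) (by
      rintro (_ | n) B hB
      · simpa [upRen] using hB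
      · simpa [upRen] using hξ n B (by simpa using hB))
    have e : ∀ ρ : ℕ → ℕ, (fun n => liftLam ρ (upRen ξ n)) = liftLam (fun n => ρ (ξ n)) := by
      intro ρ; funext n; cases n <;> rfl
    exact ⟨.lam E, fun ρ => by simp [transC, transK, (h (liftLam ρ)).2, e]⟩
  | crc s D hs ht ih =>
    intro Δ ξ hξ
    obtain ⟨E, h⟩ := ih Δ ξ hξ
    exact ⟨.crc s E hs ht, fun ρ => by simp [transC, transK, (h _).2]⟩

/-- Values are needed at variables: `𝒦⟦x⟧K` is `x⟨K⟩`, and after substitution this is `𝒦⟦V⟧K`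
because `𝒦⟦V⟧K = Ψ(V)⟨K⟩`. -/
theorem Deriv.exists_subst {S : Signature} {Γ : List (Ty S)} {M : Term S} {A : Ty S}
    (D : Deriv Γ M A) :
    ∀ (Δ : List (Ty S)) (σ : ℕ → Term S) (_ : ∀ n, IsValue (σ n))
      (E : ∀ (n : ℕ) (B : Ty S), Γ[n]? = some B → Deriv Δ (σ n) B),
      ∃ D' : Deriv Δ (M.subst σ) A, ∀ (ρ ρ' : ℕ → ℕ) (τ : ℕ → LamS1.Term S),
        (∀ n B h, τ (ρ n) = transC ρ' (E n B h)) →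
        (transC ρ D).subst τ = transC ρ' D' ∧
        ∀ K, (transK ρ D K).subst τ = transK ρ' D' (K.subst τ) := by
  induction D with
  | const Γ a => intro Δ σ _ _; exact ⟨.const Δ a, fun _ _ _ _ => ⟨rfl, fun _ => rfl⟩⟩
  | blame Γ p A => intro Δ σ _ _; exact ⟨.blame Δ p A, fun _ _ _ _ => ⟨rfl, fun _ => rfl⟩⟩
  | var n h =>
    intro Δ σ hσ E
    refine ⟨E n _ h, fun ρ ρ' τ hτ => ?_⟩
    simp [Term.subst, transC, transK, LamS1.Term.subst, hτ n _ h, transK_value ρ' (E n _ h) (hσ n)]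
  | op o D₁ D₂ ih₁ ih₂ =>
    intro Δ σ hσ E
    obtain ⟨E₁, h₁⟩ := ih₁ Δ σ hσ E
    obtain ⟨E₂, h₂⟩ := ih₂ Δ σ hσ E
    exact ⟨.op o E₁ E₂, fun ρ ρ' τ hτ => by
      simp [transC, transK, LamS1.Term.subst, (h₁ ρ ρ' τ hτ).1, (h₂ ρ ρ' τ hτ).1]⟩
  | app D₁ D₂ ih₁ ih₂ =>
    intro Δ σ hσ E
    obtain ⟨E₁, h₁⟩ := ih₁ Δ σ hσ E
    obtain ⟨E₂, h₂⟩ := ih₂ Δ σ hσ E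
    exact ⟨.app E₁ E₂, fun ρ ρ' τ hτ => by
      simp [transC, transK, LamS1.Term.subst, (h₁ ρ ρ' τ hτ).1, (h₂ ρ ρ' τ hτ).1]⟩
  | crcV d hU D hd hd' ht ih =>
    intro Δ σ hσ E
    obtain ⟨E₁, h₁⟩ := ih Δ σ hσ E
    exact ⟨.crcV d (hU.subst σ) E₁ hd hd' ht, fun ρ ρ' τ hτ => by
      simp [transC, transK, LamS1.Term.subst, (h₁ ρ ρ' τ hτ).1]⟩
  | @lam Γ M A B D ih =>
    intro Δ σ hσ E
    have hr : ∀ (n : ℕ) (C : Ty S) (h : Γ[n]? = some C),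
        ∃ D' : Deriv (A :: Δ) ((σ n).rename Nat.succ) C, ∀ ρ : ℕ → ℕ,
          transC ρ D' = transC (fun n => ρ (n + 1)) (E n C h) := by
      intro n C h
      obtain ⟨D', hD⟩ := (E n C h).exists_rename (A :: Δ) Nat.succ (by intro m B hB; simpa using hB)
      exact ⟨D', fun ρ => (hD ρ).1⟩
    choose F hF using hr
    -- One source binder corresponds to the two target binders `x` and `κ`: index `0` goes to `1`,
    -- and weakening by one becomes weakening by two.
    have hF0 : ∀ (n : ℕ) (C : Ty S) (_ : (A :: Γ)[n]? = some C),
        ∃ D' : Deriv (A :: Δ) (upSub σ n) C, ∀ (ρ ρ' : ℕ → ℕ) (τ : ℕ → LamS1.Term S),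
        (∀ n B h, τ (ρ n) = transC ρ' (E n B h)) →
        LamS1.upSub (LamS1.upSub τ) (liftLam ρ n) = transC (liftLam ρ') D' := by
      rintro (_ | n) C h
      · exact ⟨.var 0 (by simpa using h), fun _ _ _ _ => rfl⟩
      · have h' : Γ[n]? = some C := by simpa using h
        refine ⟨F n C h', fun ρ ρ' τ hτ => ?_⟩
        refine Eq.trans ?_ (hF n C h' _).symm
        simp only [liftLam, LamS1.upSub, hτ n C h']
        rw [(trans_rename (E n C h') _ _ _ fun _ => rfl).1,
          (trans_rename (E n C h') _ _ _ fun _ => rfl).1]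
    choose G hG using hF0
    obtain ⟨E₁, h₁⟩ := ih (A :: Δ) (upSub σ) (by
      rintro (_ | n)
      · exact .var 0
      · exact (hσ n).rename _) G
    refine ⟨.lam E₁, fun ρ ρ' τ hτ => ?_⟩
    have h := (h₁ (liftLam ρ) (liftLam ρ') (LamS1.upSub (LamS1.upSub τ))
      fun n B h => hG n B h ρ ρ' τ hτ).2
    simp [transC, transK, LamS1.Term.subst, h, LamS1.upSub]
  | crc s D hs ht ih =>
    intro Δ σ hσ E
    obtain ⟨E₁, h₁⟩ := ih Δ σ hσ E
    refine ⟨.crc s E₁ hs ht, fun ρ ρ' τ hτ => ?_⟩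
    have h := (h₁ (fun n => ρ n + 1) (fun n => ρ' n + 1) (LamS1.upSub τ) (by
      intro n B h
      simp only [LamS1.upSub, hτ n B h]
      exact (trans_rename (E n B h) _ _ _ fun _ => rfl).1)).2
    simp [transC, transK, LamS1.Term.subst, h, LamS1.upSub, (h₁ ρ ρ' τ hτ).2]

/-- Substitution of a closed value for the only free variable. -/
theorem Deriv.exists_subst1 {S : Signature} {M V : Term S} {A B : Ty S} (D : Deriv [A] M B)
    (DV : Deriv [] V A) (hV : IsValue V) :
    ∃ D' : Deriv [] (M.subst1 V) B, ∀ W,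
      (transK (liftLam id) D (.var 0)).subst2 (transC id DV) W = transK id D' W := by
  have hE : ∀ (n : ℕ) (C : Ty S) (_ : [A][n]? = some C),
      ∃ D' : Deriv [] ((fun n => match n with | 0 => V | n + 1 => .var n : ℕ → Term S) n) C,
        n = 0 ∧ transC id D' = transC id DV := by
    rintro (_ | n) C h
    · obtain rfl : A = C := by simpa using h
      exact ⟨DV, rfl, rfl⟩
    · simp at h
  choose E hE0 hE using hE
  obtain ⟨D', h⟩ := D.exists_subst [] _ (by
    rintro (_ | n)
    · exact hV
    · exact .var n) E
  refine ⟨D', fun W => (h (liftLam id) id _ ?_).2 (.var 0)⟩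
  intro n C hn
  rw [hE]
  obtain rfl := hE0 n C hn
  rfl

open LamS1 (Steps Steps₁)

/-! ### Simulation of reduction -/

theorem IsUncoerced.transC {S : Signature} {U : Term S} (hU : IsUncoerced U) {Γ : List (Ty S)}
    {A : Ty S} (D : Deriv Γ U A) (ρ : ℕ → ℕ) : LamS1.IsUncoerced (transC ρ D) := by
  cases hU with
  | const a => cases D; exact .const a
  | lam M => cases D; exact .lam _

theorem IsDelayed.trans {S : Signature} {d : Crc S} (hd : IsDelayed d) :
    LamS1.IsDelayed d.trans := by
  cases hd <;> constructor

theorem IsValue.transC {S : Signature} {V : Term S} (hV : IsValue V) {Γ : List (Ty S)}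
    {A : Ty S} (D : Deriv Γ V A) (ρ : ℕ → ℕ) : LamS1.IsValue (transC ρ D) := by
  cases hV with
  | var n => cases D; exact .var _
  | unc hU => exact .unc (hU.transC D ρ)
  | crcV hU hd => cases D with | crcV d _ D _ _ _ => exact .crcV (hU.transC D ρ) hd.trans

theorem Deriv.const_inv {S : Signature} {Γ : List (Ty S)} {M : Term S} {A : Ty S}
    (D : Deriv Γ M A) {a : S.Const} (h : M = .const a) (ρ : ℕ → ℕ) :
    A = .base (S.tyConst a) ∧ transC ρ D = .const a := by
  cases D <;> cases h
  exact ⟨rfl, rfl⟩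

theorem Deriv.blame_inv {S : Signature} {Γ : List (Ty S)} {M : Term S} {A : Ty S}
    (D : Deriv Γ M A) {p : S.Label} (h : M = .blame p) (ρ : ℕ → ℕ) :
    transC ρ D = .blame p ∧ ∀ K, transK ρ D K = .blame p := by
  cases D <;> cases h
  exact ⟨rfl, fun _ => rfl⟩

/-- The continuation `id` may be dropped. -/
theorem steps_transK_id {S : Signature} {M : Term S} {A : Ty S} (D : Deriv [] M A) :
    Steps (transK id D (.coe (.id A.trans))) (transC id D) := by
  cases D with
  | var n h => simp at h
  | const => exact (LamS1.RedC.id (.const _)).steps.steps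
  | lam D => exact (LamS1.RedC.id (.lam _)).steps.steps
  -- The coercion `d` is merged with the identity, which returns `d`, and is then attached to the
  -- value again.
  | crcV d hU D hd hd' ht =>
    exact ((LamS1.steps_crcV_crc (hU.transC D id) hd'.trans (Crc.trans_comp_id ht)).trans
      (LamS1.RedC.crc (hU.transC D id) hd'.trans).steps).steps
  | op => exact .refl _
  | app => exact .refl _
  | blame => exact .refl _
  | crc s D hs ht =>
    have h := LamS1.steps_letIn_cmp (Crc.trans_comp_id ht)
      (transK (fun n => id n + 1) D (.var 0))
    rw [transK_subst1] at h
    exact h.steps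

theorem redE_simulation {S : Signature} {M N : Term S} (h : RedE M N) {A : Ty S}
    (D : Deriv [] M A) : ∃ D' : Deriv [] N A,
      (∀ s, Steps₁ (transK id D (.coe s)) (transK id D' (.coe s))) ∧
      Steps₁ (transC id D) (transC id D') := by
  -- An `e`-redex is neither a value nor a coercion application, so its `𝒞` is `𝒦` at the identity;
  -- that identity is afterwards evaluated away in front of the contractum.
  suffices hs : ∃ D' : Deriv [] N A,
      ∀ s, Steps₁ (transK id D (.coe s)) (transK id D' (.coe s)) by
    obtain ⟨D', h'⟩ := hs
    refine ⟨D', h', ?_⟩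
    rw [transC_other id D (fun hv => by cases hv <;> cases h <;> rename_i hU <;> cases hU)
      (by rintro _ _ rfl; cases h)]
    exact (h' _).trans_left (steps_transK_id D')
  cases h with
  | @op o a b c h =>
    cases D with
    | op _ D₁ D₂ =>
      obtain ⟨h₁, e₁⟩ := D₁.const_inv rfl id
      obtain ⟨h₂, e₂⟩ := D₂.const_inv rfl id
      obtain ⟨c', hc, hty⟩ := S.delta_spec o a b (Ty.base.inj h₁).symm (Ty.base.inj h₂).symm
      rw [h] at hc
      obtain rfl := Option.some.inj hc
      refine ⟨hty ▸ Deriv.const [] c, fun s => ?_⟩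
      rw [transK_value id _ (.unc (.const c)), (Deriv.const_inv _ rfl id).2]
      simp only [transK, e₁, e₂]
      exact fun E => (LamS1.RedE.op h).steps (.crcL E _)
  | beta hV =>
    cases D with
    | app D₁ D₂ =>
      cases D₁ with
      | lam D =>
        obtain ⟨D', h⟩ := D.exists_subst1 D₂ hV
        refine ⟨D', fun s => ?_⟩
        rw [← h]
        exact (LamS1.RedE.beta (hV.transC D₂ id) LamS1.isValue_coe).steps
  | @wrap U V s₁ s₂ hU hV =>
    cases D with
    | app D₁ D₂ =>
      cases D₁ with
      | crcV _ _ D hd _ ht =>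
        cases ht with
        | arr hs ht =>
          refine ⟨.crc _ (.app D (.crc _ D₂ hd.space_of_arr.1 hs)) hd.space_of_arr.2 ht,
            fun s => ?_⟩
          -- The target rule yields literally `𝒦` of the source contractum, once the shift under the
          -- fresh `κ` is absorbed into the index map.
          have := (LamS1.RedE.wrap (s := s₁.trans) (t := s₂.trans) (hU.transC D id)
            (hV.transC D₂ id) (LamS1.isValue_coe (s := s))).steps
          simp only [(trans_rename _ _ _ _ fun _ => rfl).1] at this
          simp only [transK, LamS.transC, transK_value _ D₂ hV]
          exact this

theorem redC_simulation {S : Signature} {M N : Term S} (h : RedC M N) {A : Ty S}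
    (D : Deriv [] M A) : ∃ D' : Deriv [] N A, Steps₁ (transC id D) (transC id D') := by
  cases h with
  | id hU =>
    cases D with
    | crc _ D _ ht =>
      cases ht
      refine ⟨D, ?_⟩
      simp only [LamS.transC, transK_value _ D hU.isValue]
      exact (LamS1.RedC.id (hU.transC D id)).steps
  | fail hU =>
    cases D with
    | crc _ D _ ht =>
      refine ⟨.blame _ _ _, ?_⟩
      simp only [LamS.transC, transK_value _ D hU.isValue]
      exact (LamS1.RedC.fail (hU.transC D id)).steps
  | crc hU hd =>
    cases D with
    | crc _ D hs ht =>
      refine ⟨.crcV _ hU D hs hd ht, ?_⟩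
      simp only [LamS.transC, transK_value _ D hU.isValue]
      exact (LamS1.RedC.crc (hU.transC D id) hd.trans).steps
  | @mergeC M s t u h =>
    cases D with
    | crc _ D gt ht =>
      cases D with
      | crc _ D gs hs =>
        obtain ⟨u', e, gu, hu, et, -⟩ := Crc.comp_spec s t gs gt hs ht
        rw [h] at e
        obtain rfl := Option.some.inj e
        refine ⟨.crc _ D gu hu, ?_⟩
        -- `M⟨s⟩⟨t⟩` translates to a `let` that composes the two coercions before `M` is run, so
        -- merging happens eagerly on both sides.
        have := LamS1.steps_letIn_cmp et (transK (fun n => id n + 1) D (.var 0))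
        rwa [transK_subst1] at this
  | @mergeV U d t u hU hd h =>
    cases D with
    | crc _ D gt ht =>
      cases D with
      | crcV _ _ D gs _ hs =>
        obtain ⟨u', e, gu, hu, et, -⟩ := Crc.comp_spec d t gs gt hs ht
        rw [h] at e
        obtain rfl := Option.some.inj e
        refine ⟨.crc _ D gu hu, ?_⟩
        simp only [LamS.transC, transK, transK_value _ D hU.isValue]
        exact LamS1.steps_crcV_crc (hU.transC D id) hd.trans et

-- Translation of contexts and simulation of evaluation steps

/-- The translation that a context applies to the term in its hole. -/
def transAt {S : Signature} (k : Option (LamS1.Crc S)) {M : Term S} {A : Ty S}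
    (D : Deriv [] M A) : LamS1.Term S :=
  match k with
  | none => transC id D
  | some s => transK id D (.coe s)

/-- The translation of `ℰ[M]` is a target context applied to the translation of `M`, where the
target context depends on the derivation for `M` only through its type. -/
theorem Ctx.exists_trans {S : Signature} {b : Bool} (E : Ctx S b) {M : Term S} {A : Ty S}
    (D : Deriv [] (E.plug M) A) :
    ∃ (B : Ty S) (DM : Deriv [] M B) (k : Option (LamS1.Crc S)) (E' : LamS1.Ctx S),
      k.isSome = b ∧ transC id D = E'.plug (transAt k DM) ∧
      ∀ {N : Term S} (DN : Deriv [] N B), ∃ D' : Deriv [] (E.plug N) A,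
        transC id D' = E'.plug (transAt k DN) := by
  induction E generalizing M with
  | hole => exact ⟨A, D, none, .hole, rfl, rfl, fun DN => ⟨DN, rfl⟩⟩
  | opL E o N ih =>
    obtain ⟨B, DM, k, E', -, e, h⟩ := ih D
    cases DM with
    | op _ D₁ D₂ =>
      -- If the outer context supplies no continuation, `𝒞` supplies the identity at the result
      -- type, which is the default value here.
      refine ⟨_, D₁, none, .opL (.crcL E' (.coe (k.getD (.id (.base (S.opRes o)))))) o
        (transC id D₂), rfl, e.trans ?_, fun DN => ?_⟩
      · cases k <;> rfl
      · obtain ⟨D', h'⟩ := h (.op o DN D₂)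
        exact ⟨D', h'.trans (by cases k <;> rfl)⟩
  | opR E o V hV ih =>
    obtain ⟨B, DM, k, E', -, e, h⟩ := ih D
    cases DM with
    | op _ D₁ D₂ =>
      refine ⟨_, D₂, none, .opR (.crcL E' (.coe (k.getD (.id (.base (S.opRes o)))))) o
        (transC id D₁) (hV.transC D₁ id), rfl, e.trans ?_, fun DN => ?_⟩
      · cases k <;> rfl
      · obtain ⟨D', h'⟩ := h (.op o D₁ DN)
        exact ⟨D', h'.trans (by cases k <;> rfl)⟩
  | appL E N ih =>
    obtain ⟨B, DM, k, E', -, e, h⟩ := ih D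
    cases DM with
    | app D₁ D₂ =>
      refine ⟨_, D₁, none, .appL E' (transC id D₂) (.coe (k.getD (.id B.trans))), rfl, e.trans ?_,
        fun DN => ?_⟩
      · cases k <;> rfl
      · obtain ⟨D', h'⟩ := h (.app DN D₂)
        exact ⟨D', h'.trans (by cases k <;> rfl)⟩
  | appR E V hV ih =>
    obtain ⟨B, DM, k, E', -, e, h⟩ := ih D
    cases DM with
    | app D₁ D₂ =>
      refine ⟨_, D₂, none, .appM E' (transC id D₁) (hV.transC D₁ id) (.coe (k.getD (.id B.trans))),
        rfl, e.trans ?_, fun DN => ?_⟩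
      · cases k <;> rfl
      · obtain ⟨D', h'⟩ := h (.app D₁ DN)
        exact ⟨D', h'.trans (by cases k <;> rfl)⟩
  | crc F s ih =>
    obtain ⟨B, DM, k, E', hk, e, h⟩ := ih D
    obtain rfl : k = none := by simpa using hk
    cases DM with
    | crc _ D₁ gs hs =>
      -- No frame is added: `s` becomes the continuation of the hole. None was pending, since two
      -- coercion frames are never adjacent.
      exact ⟨_, D₁, some s.trans, E', rfl, e, fun DN => h (.crc s DN gs hs)⟩


/-- One source step is simulated by one or more target steps, unless it aborts. -/
theorem Eval.simulation {S : Signature} {M N : Term S} (h : Eval M N) {A : Ty S}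
    (D : Deriv [] M A) : ∃ D' : Deriv [] N A,
      LamS1.Evals (transC id D) (transC id D') ∧
      (Relation.TransGen LamS1.Eval (transC id D) (transC id D') ∨ ∃ p, N = .blame p) := by
  rcases h with (⟨E, hr⟩ | @⟨b, E, p, -⟩) | ⟨F, hr⟩
  · obtain ⟨B, DM, k, E', -, e, h⟩ := E.exists_trans D
    obtain ⟨DN, h₁, h₂⟩ := redE_simulation hr DM
    obtain ⟨D', e'⟩ := h DN
    have : Relation.TransGen LamS1.Eval (transC id D) (transC id D') := by
      rw [e, e']
      cases k with
      | none => exact h₂ E'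
      | some s => exact h₁ s E'
    exact ⟨D', this.to_reflTransGen, .inl this⟩
  · obtain ⟨B, DM, k, E', -, e, -⟩ := E.exists_trans D
    refine ⟨.blame _ _ _, ?_, .inr ⟨p, rfl⟩⟩
    have hb : transAt k DM = .blame p := by
      obtain ⟨h₁, h₂⟩ := DM.blame_inv rfl id
      cases k with
      | none => exact h₁
      | some s => exact h₂ _
    rw [e, hb]
    -- The target context can be empty although the source one is not: `(blame p)⟨s⟩` already
    -- translates to `blame p`.
    by_cases hE : E' = .hole
    · subst hE; exact .refl
    · exact .single (.inl (.abort E' p hE))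
  · obtain ⟨B, DM, k, E', hk, e, h⟩ := F.exists_trans D
    obtain rfl : k = none := by simpa using hk
    obtain ⟨DN, h₁⟩ := redC_simulation hr DM
    obtain ⟨D', e'⟩ := h DN
    have : Relation.TransGen LamS1.Eval (transC id D) (transC id D') := by
      rw [e, e']
      exact h₁ E'
    exact ⟨D', this.to_reflTransGen, .inl this⟩

theorem Evals.simulation {S : Signature} {M N : Term S} (h : Evals M N) {A : Ty S}
    (D : Deriv [] M A) : ∃ D' : Deriv [] N A, LamS1.Evals (transC id D) (transC id D') := by
  induction h with
  | refl => exact ⟨D, .refl⟩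
  | tail _ h ih =>
    obtain ⟨D₁, h₁⟩ := ih
    obtain ⟨D₂, h₂, -⟩ := h.simulation D₁
    exact ⟨D₂, h₁.trans h₂⟩

/-! ### Progress in the source calculus -/

/-- Delayed coercions end at `⋆` or at a function type, so a coerced value never has base type. -/
theorem IsValue.const_of_base {S : Signature} {V : Term S} (hV : IsValue V) {ι : S.Base}
    (D : Deriv [] V (.base ι)) : ∃ a, V = .const a ∧ S.tyConst a = ι := by
  cases hV with
  | var n => cases D with | var _ h => simp at h
  | unc hU =>
    cases hU with
    | const a => exact ⟨a, rfl, (Ty.base.inj (D.const_inv rfl id).1).symm⟩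
    | lam M => cases D
  | crcV hU hd =>
    cases D with
    | crcV _ _ _ _ _ ht => cases hd <;> cases ht

theorem IsValue.app_red {S : Signature} {V W : Term S} (hV : IsValue V) (hW : IsValue W)
    {A B : Ty S} (D : Deriv [] V (.arr A B)) : ∃ N, RedE (.app V W) N := by
  cases hV with
  | var n => cases D with | var _ h => simp at h
  | unc hU =>
    cases hU with
    | const a => cases D
    | lam M => exact ⟨_, .beta hW⟩
  | crcV hU hd =>
    cases D with
    | crcV _ _ _ _ _ ht =>
      cases hd with
      | inj => cases ht
      | arr s t => exact ⟨_, .wrap hU hW⟩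

theorem IsUncoerced.ne_dyn {S : Signature} {U : Term S} (hU : IsUncoerced U) {Γ : List (Ty S)}
    {A : Ty S} (D : Deriv Γ U A) : A ≠ .dyn := by
  cases hU <;> cases D <;> simp

theorem IsValue.crc_red {S : Signature} {V : Term S} (hV : IsValue V) {A B : Ty S}
    (D : Deriv [] V A) {s : Crc S} (gs : Gram .space s) (hs : CrcTy s A B) :
    ∃ N, RedC (.crc V s) N := by
  cases hV with
  | var n => cases D with | var _ h => simp at h
  | unc hU =>
    cases hs with
    | id => exact ⟨_, .id hU⟩
    | inj => exact ⟨_, .crc hU (.inj _ _)⟩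
    | proj => exact absurd rfl (hU.ne_dyn D)
    | arr => exact ⟨_, .crc hU (.arr _ _)⟩
    | fail => exact ⟨_, .fail hU⟩
  | crcV hU hd =>
    cases D with
    | crcV _ _ _ gd _ ht =>
      obtain ⟨u, e, -⟩ := Crc.comp_spec _ s gd gs ht hs
      exact ⟨_, .mergeV hU hd e⟩

/-- The induction carries the surrounding context because a subterm may step only where the frames
permit. The condition `hb` keeps coercion frames from being adjacent. -/
theorem progress_in_ctx {S : Signature} {Γ : List (Ty S)} {M : Term S} {A : Ty S}
    (D : Deriv Γ M A) (hΓ : Γ = []) (hM : ¬ IsValue M) {b : Bool} (E : Ctx S b)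
    (hb : b = false ∨ ∀ N s, M ≠ .crc N s) :
    (E.IsHole ∧ ∃ p, M = .blame p) ∨ ∃ N, Eval (E.plug M) N := by
  induction D generalizing b with
  | const Γ a => exact absurd (.unc (.const a)) hM
  | var n h => exact absurd (.var n) hM
  | lam D => exact absurd (.unc (.lam _)) hM
  | crcV d hU D hd hd' ht => exact absurd (.crcV hU hd') hM
  | blame Γ p A =>
    by_cases hE : E.IsHole
    · exact .inl ⟨hE, p, rfl⟩
    · exact .inr ⟨_, .inl (.abort E p hE)⟩
  | @op Γ M N o D₁ D₂ ih₁ ih₂ =>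
    subst hΓ
    right
    by_cases h₁ : IsValue M
    · by_cases h₂ : IsValue N
      · obtain ⟨a, rfl, ha⟩ := h₁.const_of_base D₁
        obtain ⟨a', rfl, ha'⟩ := h₂.const_of_base D₂
        obtain ⟨c, hc, -⟩ := S.delta_spec o a a' ha ha'
        exact ⟨_, .inl (.ctx E (.op hc))⟩
      · exact (ih₂ rfl h₂ (.opR E o M h₁) (.inl rfl)).resolve_left fun h => h.1.elim
    · exact (ih₁ rfl h₁ (.opL E o N) (.inl rfl)).resolve_left fun h => h.1.elim
  | @app Γ M N A B D₁ D₂ ih₁ ih₂ =>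
    subst hΓ
    right
    by_cases h₁ : IsValue M
    · by_cases h₂ : IsValue N
      · obtain ⟨R, hR⟩ := h₁.app_red h₂ D₁
        exact ⟨_, .inl (.ctx E hR)⟩
      · exact (ih₂ rfl h₂ (.appR E M h₁) (.inl rfl)).resolve_left fun h => h.1.elim
    · exact (ih₁ rfl h₁ (.appL E N) (.inl rfl)).resolve_left fun h => h.1.elim
  | @crc Γ M A B s D gs hs ih =>
    subst hΓ
    right
    obtain rfl : b = false := hb.resolve_right fun h => h _ _ rfl
    by_cases h₁ : IsValue M
    · obtain ⟨R, hR⟩ := h₁.crc_red D gs hs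
      exact ⟨_, .inr (.ctx E hR)⟩
    -- Nested coercions are merged at once; a coercion frame is entered only if the body is not
    -- itself a coercion application.
    · by_cases h₂ : ∃ N t, M = .crc N t
      · obtain ⟨N, t, rfl⟩ := h₂
        cases D with
        | crc _ _ gt ht =>
          obtain ⟨u, e, -⟩ := Crc.comp_spec t s gt gs ht hs
          exact ⟨_, .inr (.ctx E (.mergeC e))⟩
      · push Not at h₂
        exact (ih rfl h₁ (.crc E s) (.inr h₂)).resolve_left fun h => h.1.elim

theorem Deriv.progress {S : Signature} {M : Term S} {A : Ty S} (D : Deriv [] M A) :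
    IsValue M ∨ (∃ p, M = .blame p) ∨ ∃ N, Eval M N := by
  by_cases hM : IsValue M
  · exact .inl hM
  · exact .inr ((progress_in_ctx D rfl hM .hole (.inl rfl)).imp_left And.right)

theorem Ctx.plug_eq_blame {S : Signature} {b : Bool} {E : Ctx S b} {M : Term S} {p : S.Label}
    (h : E.plug M = .blame p) : E.IsHole ∧ M = .blame p := by
  induction E generalizing M with
  | hole => exact ⟨trivial, h⟩
  | _ => rename_i ih; cases (ih h).2

theorem not_eval_blame {S : Signature} {p : S.Label} {N : Term S} : ¬ Eval (.blame p) N := by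
  intro h
  generalize hM : Term.blame p = M at h
  rcases h with (⟨E, hr⟩ | ⟨E, q, hE⟩) | ⟨E, hr⟩
  · rw [(Ctx.plug_eq_blame hM.symm).2] at hr; cases hr
  · exact hE (Ctx.plug_eq_blame hM.symm).1
  · rw [(Ctx.plug_eq_blame hM.symm).2] at hr; cases hr

end LamS

/-- An infinite sequence from a set that is closed under taking some successor. -/
theorem exists_infinite_sequence {α : Type*} {r : α → α → Prop} (P : α → Prop)
    (hP : ∀ x, P x → ∃ y, r x y ∧ P y) {x : α} (hx : P x) :
    ∃ f : ℕ → α, f 0 = x ∧ ∀ n, r (f n) (f (n + 1)) := by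
  choose g hg hg' using hP
  let F : ℕ → {y // P y} := fun n => Nat.rec ⟨x, hx⟩ (fun _ y => ⟨g y y.2, hg' y y.2⟩) n
  exact ⟨fun n => (F n).1, rfl, fun n => hg _ _⟩

-- Trichotomy of source outcomes and preservation of divergence

namespace LamS

/-- A closed term of base type diverges, evaluates to a constant, or aborts. -/
theorem Deriv.trichotomy {S : Signature} {M : Term S} {ι : S.Base} (D : Deriv [] M (.base ι)) :
    (∃ a, Evals M (.const a)) ∨ (∃ p, Evals M (.blame p)) ∨ Diverges M := by
  by_contra! hc
  obtain ⟨h₁, h₂, h₃⟩ := hc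
  refine h₃ ?_
  exact exists_infinite_sequence (r := Eval) (fun N => Evals M N) (x := M)
    (fun N hN => by
      -- Preservation is read off from the simulation, which also returns a derivation of the
      -- reduct.
      obtain ⟨DN, -⟩ := Evals.simulation hN D
      rcases DN.progress with hV | ⟨p, rfl⟩ | ⟨N', hN'⟩
      · obtain ⟨a, rfl, -⟩ := hV.const_of_base DN
        exact absurd hN (h₁ a)
      · exact absurd hN (h₂ p)
      · exact ⟨N', hN', hN.tail hN'⟩) .refl

/-- The invariant is that a target term reaches the translation of some diverging source term. When
it already is that translation, the next source step forces a target step. -/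
theorem Diverges.simulation {S : Signature} {M : Term S} (h : Diverges M) {A : Ty S}
    (D : Deriv [] M A) : LamS1.Diverges (transC id D) := by
  have tail : ∀ {M : Term S}, Diverges M → ∃ N, Eval M N ∧ Diverges N := by
    rintro _ ⟨f, rfl, hf⟩
    exact ⟨f 1, hf 0, fun n => f (n + 1), rfl, fun n => hf (n + 1)⟩
  exact exists_infinite_sequence (r := LamS1.Eval)
    (fun L => ∃ (N : Term S) (DN : Deriv [] N A), Diverges N ∧ LamS1.Evals L (transC id DN))
    (x := transC id D) (by
      rintro L ⟨N, DN, hN, hL⟩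
      rcases hL.cases_head with rfl | ⟨L', hL', hL''⟩
      · obtain ⟨N', hs, hN'⟩ := tail hN
        obtain ⟨DN', -, hsim⟩ := hs.simulation DN
        rcases hsim with hsim | ⟨p, rfl⟩
        · obtain ⟨L', hL', hL''⟩ := Relation.TransGen.head'_iff.1 hsim
          exact ⟨L', hL', N', DN', hN', hL''⟩
        · obtain ⟨_, hb, -⟩ := tail hN'
          exact absurd hb not_eval_blame
      · exact ⟨L', hL', N, DN, hN, hL''⟩) ⟨M, D, h, .refl⟩

end LamS

-- Uniqueness of target outcomes

namespace LamS1

/-- By determinism, one of two evaluation sequences from the same term extends the other. -/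
theorem Evals.eq_of_normal {S : Signature} {L M N : Term S} (hM : Evals L M) (hN : Evals L N)
    (nM : ∀ M', ¬ Eval M M') (nN : ∀ N', ¬ Eval N N') : M = N := by
  induction hM using Relation.ReflTransGen.head_induction_on with
  | refl =>
    rcases hN.cases_head with h | ⟨_, h, -⟩
    · exact h
    · exact absurd h (nM _)
  | head h _ ih =>
    rcases hN.cases_head with rfl | ⟨_, h', hN'⟩
    · exact absurd h (nN _)
    · rw [h'.deterministic h] at hN'
      exact ih hN'

theorem Evals.not_diverges {S : Signature} {L M : Term S} (hM : Evals L M)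
    (nM : ∀ M', ¬ Eval M M') : ¬ Diverges L := by
  induction hM using Relation.ReflTransGen.head_induction_on with
  | refl => rintro ⟨f, rfl, hf⟩; exact nM _ (hf 0)
  | head h _ ih =>
    rintro ⟨f, rfl, hf⟩
    exact ih ⟨fun n => f (n + 1), (hf 0).deterministic h, fun n => hf (n + 1)⟩

end LamS1

theorem mainTheorem1 (S : Signature) (M : LamS.Term S) (ι : S.Base)
    (D : LamS.Deriv [] M (.base ι)) :
    (∀ a : S.Const,
      LamS.Evals M (.const a) ↔ LamS1.Evals (LamS.transC id D) (.const a)) ∧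
    (∀ p : S.Label,
      LamS.Evals M (.blame p) ↔ LamS1.Evals (LamS.transC id D) (.blame p)) ∧
    (LamS.Diverges M ↔ LamS1.Diverges (LamS.transC id D)) := by
  have hc : ∀ a, LamS.Evals M (.const a) → LamS1.Evals (LamS.transC id D) (.const a) := by
    intro a h
    obtain ⟨D', h'⟩ := h.simulation D
    rwa [(D'.const_inv rfl id).2] at h'
  have hb : ∀ p, LamS.Evals M (.blame p) → LamS1.Evals (LamS.transC id D) (.blame p) := by
    intro p h
    obtain ⟨D', h'⟩ := h.simulation D
    rwa [(D'.blame_inv rfl id).1] at h'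
  have nc : ∀ (a : S.Const) N, ¬ LamS1.Eval (.const a) N := fun _ _ => LamS1.not_eval_const
  have nb : ∀ (p : S.Label) N, ¬ LamS1.Eval (.blame p) N := fun _ _ => LamS1.not_eval_blame
  refine ⟨fun a => ⟨hc a, fun h => ?_⟩, fun p => ⟨hb p, fun h => ?_⟩,
    fun h => h.simulation D, fun h => ?_⟩
  -- Each source outcome is carried to the target; uniqueness there refutes all but the one
  -- observed.
  · rcases D.trichotomy with ⟨a', h'⟩ | ⟨p, h'⟩ | h'
    · cases h.eq_of_normal (hc a' h') (nc a) (nc a')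
      exact h'
    · cases h.eq_of_normal (hb p h') (nc a) (nb p)
    · exact absurd (h'.simulation D) (h.not_diverges (nc a))
  · rcases D.trichotomy with ⟨a', h'⟩ | ⟨p', h'⟩ | h'
    · cases h.eq_of_normal (hc a' h') (nb p) (nc a')
    · cases h.eq_of_normal (hb p' h') (nb p) (nb p')
      exact h'
    · exact absurd (h'.simulation D) (h.not_diverges (nb p))
  · rcases D.trichotomy with ⟨a', h'⟩ | ⟨p', h'⟩ | h'
    · exact absurd h ((hc a' h').not_diverges (nc a'))
    · exact absurd h ((hb p' h').not_diverges (nb p'))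
    · exact h'
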